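/- Let $\mathbb{S}^3$ be the unit sphere of $\mathbb{R}^4\cong\mathbb{H}$, identified with $\mathrm{SU}(2)$ through the quaternionic product and equipped with a Haar measure (i.e. a positive multiple of the surface measure). Let $\mathcal{L}_{\mathbb{S}^3}$ be its Laplacian, i.e. $\mathcal{L}_{\mathbb{S}^3}=\kappa\Delta$, where $\Delta$ is the Laplace–Beltrami operator of the round unit sphere and $\kappa>0$ is a normalisation constant ($\kappa=1$ for the Laplace–Beltrami operator itself, $\kappa=1/4$ for the Casimir element $X^2+Y^2+Z^2$ of left-invariant vector fields with $[X,Y]=Z$, $[Y,Z]=X$, $[Z,X]=Y$). For $\alpha>0$ the operator $(I-\mathcal{L}_{\mathbb{S}^3})^{-\alpha/2}$ on $L^2(\mathbb{S}^3)$ is $\sum_{\lambda}(1+\lambda)^{-\alpha/2}P_\lambda$, where $\lambda$ runs through the eigenvalues of $-\mathcal{L}_{\mathbb{S}^3}$ and $P_\lambda$ is the orthogonal projection onto the eigenspace; as an operator from $L^{p_1}(\mathbb{S}^3)$ into $L^{p_2}(\mathbb{S}^3)$ it is the bounded operator that coincides with this one on $L^{p_1}\cap L^2$. For $0<r\le 1$,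 a bounded linear operator $T:F_1\to F_2$ between Banach spaces is called $r$-nuclear if there are sequences $(x_n')$ in $F_1'$ and $(y_n)$ in $F_2$ with $Tx=\sum_n\langle x,x_n'\rangle y_n$ for all $x\in F_1$ and $\sum_n\|x_n'\|^r\|y_n\|^r<\infty$. For $1\le p\le\infty$ put $\tilde p=0$ if $p\le 2$, $\tilde p=\frac{p-2}{p}$ if $2<p<\infty$, and $\tilde p=1$ if $p=\infty$. Let $0<r\le 1$, $1\le p_1,p_2<\infty$, and let $q_1$ be the dual index of $p_1$, $\frac1{p_1}+\frac1{q_1}=1$. If $$\alpha>\frac3r+\frac12\left(\tilde p_2+\tilde q_1\right),$$ then $(I-\mathcal{L}_{\mathbb{S}^3})^{-\frac{\alpha}{2}}$ exists as a bounded operator from $L^{p_1}(\mathbb{S}^3)$ into $L^{p_2}(\mathbb{S}^3)$ and is $r$-nuclear. -/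

import Mathlib

open MeasureTheory Quaternion
open scoped ENNReal Manifold ContDiff

/-! ### `r`-nuclear operators -/

/-- A bounded operator `T : F₁ → F₂` is `r`-nuclear if there are sequences `x'ₙ ∈ F₁'` and
`yₙ ∈ F₂` with `T x = ∑ₙ ⟨x, x'ₙ⟩ yₙ` for all `x` and `∑ₙ ‖x'ₙ‖ ^ r * ‖yₙ‖ ^ r < ∞`. -/
def IsRNuclear {F₁ F₂ : Type*} [NormedAddCommGroup F₁] [NormedSpace ℂ F₁]
    [NormedAddCommGroup F₂] [NormedSpace ℂ F₂] (r : ℝ) (T : F₁ →L[ℂ] F₂) : Prop :=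
  ∃ (x' : ℕ → F₁ →L[ℂ] ℂ) (y : ℕ → F₂),
    (Summable fun n => ‖x' n‖ ^ r * ‖y n‖ ^ r) ∧ ∀ x, HasSum (fun n => x' n x • y n) (T x)

/-- The exponent `p̃`: it is `0` for `1 ≤ p ≤ 2`, `(p - 2) / p` for `2 < p < ∞`, `1` for `p = ∞`. -/
noncomputable def tildeExp (p : ℝ≥0∞) : ℝ :=
  if p ≤ 2 then 0 else if p = ⊤ then 1 else (p.toReal - 2) / p.toReal

/-! ### The sphere `𝕊³` as the compact Lie group of unit quaternions -/

instance instFactFinrankQuaternion : Fact (Module.finrank ℝ ℍ[ℝ] = 3 + 1) :=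
  ⟨Quaternion.finrank_eq_four⟩

noncomputable instance instMeasurableSpaceQuaternion : MeasurableSpace ℍ[ℝ] := borel _

instance instBorelSpaceQuaternion : BorelSpace ℍ[ℝ] := ⟨rfl⟩

/-- The unit sphere `𝕊³` of `ℍ ≅ ℝ⁴`. It carries the quaternionic product, the subspace topology,
its Borel sets, and the smooth structure given by stereographic projections. -/
abbrev S3 : Type := Metric.sphere (0 : ℍ[ℝ]) 1

/-- The imaginary quaternions `i, j, k`, an orthonormal basis of the tangent space of `𝕊³`
at `1`. -/
noncomputable def imUnit : Fin 3 → ℍ[ℝ] := ![⟨0, 1, 0, 0⟩, ⟨0, 0, 1, 0⟩, ⟨0, 0, 0, 1⟩]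

theorem imUnit_re (a : Fin 3) : (imUnit a).re = 0 := by
  fin_cases a <;> rfl

/-- The one-parameter subgroup `t ↦ exp (t v)` of `𝕊³`, where `v` is one of `i, j, k`. -/
noncomputable def oneParam (a : Fin 3) (t : ℝ) : S3 :=
  ⟨NormedSpace.exp (t • imUnit a), by
    rw [mem_sphere_zero_iff_norm, Quaternion.norm_exp]
    simp [imUnit_re]⟩

/-- The left-invariant vector field on `𝕊³` generated by `v = i, j, k`, acting on functions:
`f ↦ (x ↦ d/dt f (x exp (t v)) at t = 0)`. -/
noncomputable def leftInvDeriv (a : Fin 3) (f : S3 → ℂ) (x : S3) : ℂ :=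
  deriv (fun t : ℝ => f (x * oneParam a t)) 0

/-- The Laplace–Beltrami operator of the round unit sphere `𝕊³` on smooth functions: the sum of the
squares of the left-invariant vector fields generated by `i, j, k`, which form an orthonormal frame
(and whose integral curves are the unit speed great circles `x exp (t v) = cos t x + sin t x v`).
The Casimir element `X² + Y² + Z²` for left-invariant fields with `[X, Y] = Z`, `[Y, Z] = X`,
`[Z, X] = Y` (generated by `i/2, j/2, k/2`) is `1/4` of it. -/
noncomputable def sphereLaplacian (f : S3 → ℂ) (x : S3) : ℂ :=
  ∑ a, leftInvDeriv a (leftInvDeriv a f) x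

/-! ### Powers of `I - L`, where `L = κ Δ` -/

/-- The eigenspace in `L²(𝕊³)` of `- κ Δ` for the eigenvalue `lam`: the closed span of the classes
of smooth functions `f` with `- κ Δ f = lam f` (it is `{0}` if `lam` is not an eigenvalue). -/
noncomputable def laplaceEigenspace (μ : Measure S3) (κ lam : ℝ) : Submodule ℂ (Lp ℂ 2 μ) :=
  (Submodule.span ℂ {u : Lp ℂ 2 μ | ∃ f : S3 → ℂ, ContMDiff (𝓡 3) 𝓘(ℝ, ℂ) ∞ f ∧
    (∀ x, -((κ : ℂ) * sphereLaplacian f x) = (lam : ℂ) * f x) ∧ u =ᵐ[μ] f}).topologicalClosure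

noncomputable instance instHasOrthogonalProjectionLaplaceEigenspace
    (μ : Measure S3) (κ lam : ℝ) : (laplaceEigenspace μ κ lam).HasOrthogonalProjection :=
  inferInstanceAs (Submodule.topologicalClosure _).HasOrthogonalProjection

/-- `A` is the operator `(I - κ Δ) ^ (-α / 2)` on `L²(𝕊³)`, given by the spectral decomposition of
`- κ Δ`: `A u = ∑ (1 + lam) ^ (-α / 2) P_lam u` in `L²`, where `lam` runs through the eigenvalues of
`- κ Δ` (the terms of all other real `lam` vanish) and `P_lam` is the orthogonal projection onto
the eigenspace. -/
def IsBesselPotential (μ : Measure S3) (κ α : ℝ) (A : Lp ℂ 2 μ →L[ℂ] Lp ℂ 2 μ) : Prop :=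
  ∀ u : Lp ℂ 2 μ, HasSum
    (fun lam : ℝ => (((1 + lam) ^ (-α / 2) : ℝ) : ℂ) • (laplaceEigenspace μ κ lam).starProjection u)
    (A u)

/-- `T` is the operator `(I - κ Δ) ^ (-α / 2)` from `L^{p₁}(𝕊³)` into `L^{p₂}(𝕊³)`: the bounded
operator that agrees with the one on `L²(𝕊³)` on the dense (for `p₁ < ∞`) subspace
`L^{p₁} ∩ L²` of `L^{p₁}`. -/
def IsBesselPotentialLp (μ : Measure S3) (κ α : ℝ) (p₁ p₂ : ℝ≥0∞) [Fact (1 ≤ p₁)] [Fact (1 ≤ p₂)]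
    (T : Lp ℂ p₁ μ →L[ℂ] Lp ℂ p₂ μ) : Prop :=
  ∃ A : Lp ℂ 2 μ →L[ℂ] Lp ℂ 2 μ, IsBesselPotential μ κ α A ∧
    ∀ (u : Lp ℂ p₁ μ) (w : Lp ℂ 2 μ), u =ᵐ[μ] w → T u =ᵐ[μ] A w

/-! The normalised matrix coefficients `e_i` of the irreducible representations of SU(2) form an
orthonormal basis of `L²`, and those of degree `l`, of which there are `(l+1)²`, are eigenfunctions
of `-κΔ` with eigenvalue `κ l(l+2)`. Hence the Bessel potential is the series of rank-one operators
`(1 + κ l(l+2))^(-α/2) ⟨·, e_i⟩ e_i`. Unitarity gives `|e_i| ≤ C (l+1)^(1/2)`, and interpolation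
with the `L²` norm gives `‖e_i‖_p ≤ C (l+1)^(p̃/2)`. The `r`-nuclear sum is thus dominated by `∑
(l+1)² (l+1)^(r(-α + (p̃₂ + q̃₁)/2))`, which converges exactly in the assumed range of `α`
(`summable_norm_rpow`).

The Peter–Weyl input is proved by hand. The matrix coefficients are the coefficients in `X` of `(z -
w̄X)^m (w + z̄X)^k`, rescaled by square roots of binomials. Substitution of linear forms gives
multiplicativity (`wigner_mul`), and a transposition symmetry gives unitarity (`wigner_inv`). For
scalar `ξ` in place of `X` the product is an explicit eigenfunction (`sphereLaplacian_formPow`), and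
the coefficients inherit this. Orthogonality comes from symmetry of the Laplacian for degrees, from
a left-invariant derivative for columns, from left translation by a torus for rows; a Schur-type
argument fixes the norms (`integral_wigner_self`). Completeness is Stone–Weierstrass: the span of
the coefficients contains the algebra of the coordinates (`adjoin_le_coeffSpan`). -/

/-! ### Symmetric powers of `2 × 2` matrices -/

section SymmetricPower

open Polynomial

variable {R : Type*} [CommRing R]

/-- The product `(a + c X) ^ m * (b + d X) ^ k`, whose coefficients are the entries of a column of
the symmetric power of the matrix with rows `(a, b)` and `(c, d)`. -/
noncomputable def colPoly (a b c d : R) (m k : ℕ) : R[X] :=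
  (C a + C c * X) ^ m * (C b + C d * X) ^ k

theorem colPoly_map {S : Type*} [CommRing S] (φ : R →+* S) (a b c d : R) (m k : ℕ) :
    (colPoly a b c d m k).map φ = colPoly (φ a) (φ b) (φ c) (φ d) m k := by
  simp [colPoly]

theorem natDegree_colPoly_le (a b c d : R) (m k : ℕ) :
    (colPoly a b c d m k).natDegree ≤ m + k := by
  unfold colPoly
  compute_degree

theorem coeff_colPoly_eq_zero (a b c d : R) {m k j : ℕ} (h : m + k < j) :
    (colPoly a b c d m k).coeff j = 0 :=
  coeff_eq_zero_of_natDegree_lt ((natDegree_colPoly_le a b c d m k).trans_lt h)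

/-- Homogenization is multiplicative with respect to multiplication by a linear factor. -/
theorem sum_coeff_linear_mul {A : Type*} [CommRing A] [Algebra R A] (a c : R) (p : R[X]) (n : ℕ)
    (hp : p.natDegree ≤ n) (U V : A) :
    ∑ i ∈ Finset.range (n + 1 + 1),
        algebraMap R A (((C a + C c * X) * p).coeff i) * (U ^ (n + 1 - i) * V ^ i) =
      (algebraMap R A a * U + algebraMap R A c * V) *
        ∑ i ∈ Finset.range (n + 1), algebraMap R A (p.coeff i) * (U ^ (n - i) * V ^ i) := by
  have h1 : ∀ i, ((C a + C c * X) * p).coeff i = a * p.coeff i + c * (X * p).coeff i := by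
    intro i
    rw [add_mul, mul_assoc, coeff_add, coeff_C_mul, coeff_C_mul]
  have h2 : ∀ i, algebraMap R A (((C a + C c * X) * p).coeff i) * (U ^ (n + 1 - i) * V ^ i) =
      algebraMap R A a * (algebraMap R A (p.coeff i) * (U ^ (n + 1 - i) * V ^ i)) +
        algebraMap R A c * (algebraMap R A ((X * p).coeff i) * (U ^ (n + 1 - i) * V ^ i)) := by
    intro i
    rw [h1, map_add, map_mul, map_mul]
    ring
  rw [Finset.sum_congr rfl fun i _ => h2 i, Finset.sum_add_distrib, add_mul, Finset.mul_sum,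
    Finset.mul_sum]
  congr 1
  · rw [Finset.sum_range_succ, coeff_eq_zero_of_natDegree_lt (Nat.lt_succ_of_le hp)]
    simp only [map_zero, mul_zero, zero_mul, add_zero]
    refine Finset.sum_congr rfl fun i hi => ?_
    rw [Nat.succ_sub (Nat.lt_succ_iff.mp (Finset.mem_range.mp hi)), pow_succ]
    ring
  · rw [Finset.sum_range_succ']
    simp only [coeff_X_mul, coeff_X_mul_zero, map_zero, mul_zero, zero_mul, add_zero]
    refine Finset.sum_congr rfl fun i _ => ?_
    rw [Nat.succ_sub_succ, pow_succ]
    ring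

/-- Homogenisation turns each factor into a linear form in `U`, `V`. Allowing values in an algebra
`A` makes it possible to substitute polynomials for `U` and `V`. -/
theorem sum_coeff_colPoly {A : Type*} [CommRing A] [Algebra R A] (a b c d : R) (m k : ℕ)
    (U V : A) :
    ∑ i ∈ Finset.range (m + k + 1),
        algebraMap R A ((colPoly a b c d m k).coeff i) * (U ^ (m + k - i) * V ^ i) =
      (algebraMap R A a * U + algebraMap R A c * V) ^ m *
        (algebraMap R A b * U + algebraMap R A d * V) ^ k := by
  induction m with
  | zero =>
    induction k with
    | zero => simp [colPoly]
    | succ k ih =>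
      have h : colPoly a b c d 0 (k + 1) = (C b + C d * X) * colPoly a b c d 0 k := by
        simp only [colPoly]; ring
      rw [h, ← add_assoc, sum_coeff_linear_mul b d _ (0 + k) (natDegree_colPoly_le a b c d 0 k),
        ih]
      ring
  | succ m ih =>
    have h : colPoly a b c d (m + 1) k = (C a + C c * X) * colPoly a b c d m k := by
      simp only [colPoly]; ring
    rw [h, show m + 1 + k = m + k + 1 by ring,
      sum_coeff_linear_mul a c _ (m + k) (natDegree_colPoly_le a b c d m k), ih]
    ring

/-- The coefficients of `colPoly` are multiplicative in the matrix. -/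
theorem coeff_colPoly_mul (a b c d a' b' c' d' : R) (l k j : ℕ) (hk : k ≤ l) :
    (colPoly (a * a' + b * c') (a * b' + b * d') (c * a' + d * c') (c * b' + d * d')
        (l - k) k).coeff j =
      ∑ i ∈ Finset.range (l + 1), (colPoly a b c d (l - i) i).coeff j *
        (colPoly a' b' c' d' (l - k) k).coeff i := by
  -- Substituting the two linear factors of the left matrix for `U` and `V` composes the linear
  -- substitutions, which is matrix multiplication.
  have h := sum_coeff_colPoly (A := R[X]) a' b' c' d' (l - k) k (C a + C c * X) (C b + C d * X)
  rw [Nat.sub_add_cancel hk] at h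
  have h2 : colPoly (a * a' + b * c') (a * b' + b * d') (c * a' + d * c') (c * b' + d * d')
      (l - k) k = ∑ i ∈ Finset.range (l + 1),
        C ((colPoly a' b' c' d' (l - k) k).coeff i) * colPoly a b c d (l - i) i := by
    have e : colPoly (a * a' + b * c') (a * b' + b * d') (c * a' + d * c') (c * b' + d * d')
        (l - k) k = (algebraMap R R[X] a' * (C a + C c * X) +
          algebraMap R R[X] c' * (C b + C d * X)) ^ (l - k) *
        (algebraMap R R[X] b' * (C a + C c * X) + algebraMap R R[X] d' * (C b + C d * X)) ^ k := by
      simp only [colPoly, algebraMap_eq, C_add, C_mul]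
      congr 2 <;> ring
    rw [e, ← h]
    rfl
  rw [h2, finsetSum_coeff]
  exact Finset.sum_congr rfl fun i _ => by rw [coeff_C_mul, mul_comm]

theorem coeff_swap (p : R[X][X]) (i j : ℕ) :
    ((Bivariate.swap p).coeff i).coeff j = (p.coeff j).coeff i := by
  induction p using Polynomial.induction_on' with
  | add p q hp hq => simp [hp, hq]
  | monomial n f =>
    induction f using Polynomial.induction_on' with
    | add p q hp hq => simp only [map_add, coeff_add, hp, hq]
    | monomial m r =>
      rw [Bivariate.swap_monomial_monomial]
      simp only [coeff_monomial]
      split_ifs <;> simp_all [coeff_monomial]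

theorem coeff_add_mul_X_pow (p q : R) (l k : ℕ) :
    ((C p + C q * X) ^ l : R[X]).coeff k = (l.choose k : R) * (p ^ (l - k) * q ^ k) := by
  rw [add_comm, add_pow, finsetSum_coeff]
  simp_rw [mul_pow, ← C_pow, ← C_eq_natCast (R := R)]
  have : ∀ i, (C (q ^ i) * X ^ i * C (p ^ (l - i)) * C (l.choose i : R)).coeff k =
      if i = k then (l.choose k : R) * (p ^ (l - k) * q ^ k) else 0 := by
    intro i
    rw [show C (q ^ i) * X ^ i * C (p ^ (l - i)) * C ((l.choose i : ℕ) : R) =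
      C (q ^ i * p ^ (l - i) * (l.choose i : R)) * X ^ i by simp only [C_mul]; ring,
      coeff_C_mul_X_pow]
    by_cases h : i = k
    · subst h; simp; ring
    · rw [if_neg (Ne.symm h), if_neg h]
  rw [Finset.sum_congr rfl fun i _ => this i, Finset.sum_ite_eq']
  split_ifs with h
  · rfl
  · rw [Nat.choose_eq_zero_of_lt (by simpa using h)]; simp

theorem swap_bilinear (a b c d : R) :
    Bivariate.swap (C (C a + C c * X) + C (C b + C d * X) * X) =
      C (C a + C b * X) + C (C c + C d * X) * X := by
  simp only [map_add, map_mul, Bivariate.swap_X, Bivariate.swap_Y, Bivariate.swap_C_C]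
  ring

/-- The binomially weighted coefficients of `colPoly` are symmetric under transposition. -/
theorem choose_mul_coeff_colPoly (a b c d : R) (l k j : ℕ) :
    (l.choose k : R) * (colPoly a b c d (l - k) k).coeff j =
      (l.choose j : R) * (colPoly a c b d (l - j) j).coeff k := by
  -- Both sides are the same coefficient of the `l`-th power of `a + cX + bY + dXY`; exchanging the
  -- variables transposes the matrix.
  have h := coeff_swap ((C (C a + C c * X) + C (C b + C d * X) * X) ^ l) j k
  rw [map_pow, swap_bilinear, coeff_add_mul_X_pow, coeff_add_mul_X_pow] at h
  rw [← C_eq_natCast, ← C_eq_natCast, coeff_C_mul, coeff_C_mul] at h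
  exact h.symm

/-! ### The span of the coefficients -/

variable {K : Type*} [Field K] [Algebra K R]

/-- The span of the coefficients of all products `(a + c X) ^ m * (b + d X) ^ k`. -/
noncomputable def coeffSpan (K : Type*) [Field K] [Algebra K R] (a b c d : R) : Submodule K R :=
  Submodule.span K {f | ∃ m k j, f = (colPoly a b c d m k).coeff j}

/-- With `P = a + cX` and `Q = b + dX`, determinant one says `dP - cQ = 1`, so `dP` can be traded
for `cQ + 1` in the product rule. This expresses `c P^m Q^k` through a derivative and another
product, and so replaces the Clebsch–Gordan rule. -/
theorem derivative_colPoly_left (a b c d : R) (h : a * d - b * c = 1) (m k : ℕ) :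
    derivative (colPoly a b c d (m + 1) k) =
      ((m + 1 + k : ℕ) : R[X]) * (C c * colPoly a b c d m k) +
        (k : R[X]) * colPoly a b c d m (k - 1) := by
  have h' : (C a * C d - C b * C c : R[X]) = 1 := by
    rw [← C_mul, ← C_mul, ← C_sub, h, C_1]
  cases k with
  | zero =>
    simp [colPoly, derivative_pow]
    ring
  | succ k =>
    simp only [colPoly, derivative_mul, derivative_pow, derivative_add, derivative_C,
      derivative_X, Nat.add_sub_cancel, zero_mul, zero_add, mul_one,
      Nat.cast_add, Nat.cast_one, C_add, C_1, C_eq_natCast]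
    linear_combination ((k : R[X]) + 1) * (C a + C c * X) ^ m * (C b + C d * X) ^ k * h'

theorem derivative_colPoly_right (a b c d : R) (h : a * d - b * c = 1) (m k : ℕ) :
    derivative (colPoly a b c d m (k + 1)) =
      ((m + k + 1 : ℕ) : R[X]) * (C d * colPoly a b c d m k) -
        (m : R[X]) * colPoly a b c d (m - 1) k := by
  have h' : (C a * C d - C b * C c : R[X]) = 1 := by
    rw [← C_mul, ← C_mul, ← C_sub, h, C_1]
  cases m with
  | zero =>
    simp [colPoly, derivative_pow]
    ring
  | succ m =>
    simp only [colPoly, derivative_mul, derivative_pow, derivative_add, derivative_C,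
      derivative_X, Nat.add_sub_cancel, zero_mul, zero_add, mul_one,
      Nat.cast_add, Nat.cast_one, C_add, C_1, C_eq_natCast]
    linear_combination -((m : R[X]) + 1) * (C a + C c * X) ^ m * (C b + C d * X) ^ k * h'

theorem coeff_colPoly_mem (a b c d : R) (m k j : ℕ) :
    (colPoly a b c d m k).coeff j ∈ coeffSpan K a b c d :=
  Submodule.subset_span ⟨m, k, j, rfl⟩

theorem mem_of_natCast_mul_mem [CharZero K] {S : Submodule K R} {n : ℕ} (hn : n ≠ 0) {f : R}
    (h : (n : R) * f ∈ S) : f ∈ S := by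
  have h2 : f = (n : K)⁻¹ • ((n : R) * f) := by
    rw [← nsmul_eq_mul, ← Nat.cast_smul_eq_nsmul K, smul_smul,
      inv_mul_cancel₀ (Nat.cast_ne_zero.mpr hn), one_smul]
  rw [h2]
  exact S.smul_mem _ h

theorem natCast_mul_mem {S : Submodule K R} (n : ℕ) {f : R} (h : f ∈ S) : (n : R) * f ∈ S := by
  rw [← nsmul_eq_mul]
  exact S.toAddSubmonoid.nsmul_mem h n

theorem coeff_derivative_colPoly_mem (a b c d : R) (m k j : ℕ) :
    (derivative (colPoly a b c d m k)).coeff j ∈ coeffSpan K a b c d := by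
  rw [coeff_derivative, mul_comm]
  exact_mod_cast natCast_mul_mem (j + 1) (coeff_colPoly_mem (K := K) a b c d m k (j + 1))

theorem mul_coeff_colPoly_mem_c [CharZero K] {a b c d : R} (h : a * d - b * c = 1) (m k j : ℕ) :
    c * (colPoly a b c d m k).coeff j ∈ coeffSpan K a b c d := by
  have h1 := congrArg (fun p => coeff p j) (derivative_colPoly_left a b c d h m k)
  simp only [coeff_add, ← C_eq_natCast, coeff_C_mul] at h1
  refine mem_of_natCast_mul_mem (n := m + 1 + k) (by omega) ?_
  rw [eq_sub_iff_add_eq.mpr h1.symm]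
  exact Submodule.sub_mem _ (coeff_derivative_colPoly_mem a b c d _ _ _)
    (natCast_mul_mem _ (coeff_colPoly_mem (K := K) a b c d _ _ _))

theorem mul_coeff_colPoly_mem_d [CharZero K] {a b c d : R} (h : a * d - b * c = 1) (m k j : ℕ) :
    d * (colPoly a b c d m k).coeff j ∈ coeffSpan K a b c d := by
  have h1 := congrArg (fun p => coeff p j) (derivative_colPoly_right a b c d h m k)
  simp only [coeff_sub, ← C_eq_natCast, coeff_C_mul] at h1
  refine mem_of_natCast_mul_mem (n := m + k + 1) (by omega) ?_
  rw [sub_eq_iff_eq_add.mp h1.symm]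
  exact Submodule.add_mem _ (coeff_derivative_colPoly_mem a b c d _ _ _)
    (natCast_mul_mem _ (coeff_colPoly_mem (K := K) a b c d _ _ _))

/-- Since `aP^m Q^k = P^(m+1) Q^k - X·cP^m Q^k`, the case of `a` reduces to that of `c`, with the
coefficient index shifted by one. -/
theorem mul_coeff_colPoly_mem_a [CharZero K] {a b c d : R} (h : a * d - b * c = 1) (m k j : ℕ) :
    a * (colPoly a b c d m k).coeff j ∈ coeffSpan K a b c d := by
  have h1 : colPoly a b c d (m + 1) k =
      C a * colPoly a b c d m k + X * (C c * colPoly a b c d m k) := by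
    simp only [colPoly]; ring
  have h2 := congrArg (fun p => coeff p j) h1
  simp only [coeff_add, coeff_C_mul] at h2
  rw [eq_sub_of_add_eq h2.symm]
  refine Submodule.sub_mem _ (coeff_colPoly_mem (K := K) a b c d _ _ _) ?_
  cases j with
  | zero => simp
  | succ j =>
    rw [coeff_X_mul, coeff_C_mul]
    exact mul_coeff_colPoly_mem_c h m k j

theorem mul_coeff_colPoly_mem_b [CharZero K] {a b c d : R} (h : a * d - b * c = 1) (m k j : ℕ) :
    b * (colPoly a b c d m k).coeff j ∈ coeffSpan K a b c d := by
  have h1 : colPoly a b c d m (k + 1) =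
      C b * colPoly a b c d m k + X * (C d * colPoly a b c d m k) := by
    simp only [colPoly]; ring
  have h2 := congrArg (fun p => coeff p j) h1
  simp only [coeff_add, coeff_C_mul] at h2
  rw [eq_sub_of_add_eq h2.symm]
  refine Submodule.sub_mem _ (coeff_colPoly_mem (K := K) a b c d _ _ _) ?_
  cases j with
  | zero => simp
  | succ j =>
    rw [coeff_X_mul, coeff_C_mul]
    exact mul_coeff_colPoly_mem_d h m k j

theorem mul_mem_coeffSpan [CharZero K] {a b c d : R} (h : a * d - b * c = 1) {g : R}
    (hg : g ∈ ({a, b, c, d} : Set R)) {f : R} (hf : f ∈ coeffSpan K a b c d) :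
    g * f ∈ coeffSpan K a b c d := by
  induction hf using Submodule.span_induction with
  | mem f hf =>
    obtain ⟨m, k, j, rfl⟩ := hf
    rcases hg with rfl | rfl | rfl | rfl
    · exact mul_coeff_colPoly_mem_a h m k j
    · exact mul_coeff_colPoly_mem_b h m k j
    · exact mul_coeff_colPoly_mem_c h m k j
    · exact mul_coeff_colPoly_mem_d h m k j
  | zero => simp
  | add x y _ _ hx hy => rw [mul_add]; exact Submodule.add_mem _ hx hy
  | smul r x _ hx => rw [mul_smul_comm]; exact Submodule.smul_mem _ _ hx

/-- The coefficients span the algebra generated by the entries of a matrix of determinant one. -/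
theorem adjoin_le_coeffSpan [CharZero K] {a b c d : R} (h : a * d - b * c = 1) {f : R}
    (hf : f ∈ Algebra.adjoin K ({a, b, c, d} : Set R)) : f ∈ coeffSpan K a b c d := by
  suffices H : ∀ g ∈ coeffSpan K a b c d, f * g ∈ coeffSpan K a b c d by
    have h1 : (1 : R) ∈ coeffSpan K a b c d := by
      have := coeff_colPoly_mem (K := K) a b c d 0 0 0
      simpa [colPoly] using this
    simpa using H 1 h1
  induction hf using Algebra.adjoin_induction with
  | mem x hx => exact fun g hg => mul_mem_coeffSpan h hx hg
  | algebraMap r =>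
    intro g hg
    rw [← Algebra.smul_def]
    exact Submodule.smul_mem _ _ hg
  | add x y _ _ hx hy =>
    intro g hg
    rw [add_mul]
    exact Submodule.add_mem _ (hx g hg) (hy g hg)
  | mul x y _ _ hx hy =>
    intro g hg
    rw [mul_assoc]
    exact hx _ (hy g hg)

/-- If all values of a polynomial with coefficients in an algebra lie in a submodule, then so do
its coefficients. -/
theorem coeff_mem_of_eval_mem [CharZero K] (E : Submodule K R) (p : R[X])
    (h : ∀ ξ : K, p.eval (algebraMap K R ξ) ∈ E) (j : ℕ) : p.coeff j ∈ E := by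
  -- A functional killing `E` sends `p` to a scalar polynomial that vanishes on the infinite field
  -- `K`; functionals separate points of the quotient.
  rw [← Submodule.Quotient.mk_eq_zero, ← Module.forall_dual_apply_eq_zero_iff K]
  intro ψ
  set Λ : R →ₗ[K] K := ψ ∘ₗ E.mkQ with hΛ
  let q : K[X] := ∑ i ∈ Finset.range (p.natDegree + 1), C (Λ (p.coeff i)) * X ^ i
  have hq : q = 0 := by
    refine Polynomial.funext fun ξ => ?_
    have h1 : Λ (p.eval (algebraMap K R ξ)) = 0 := by
      simp [hΛ, (Submodule.Quotient.mk_eq_zero E).mpr (h ξ)]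
    rw [eval_eq_sum_range, map_sum] at h1
    rw [eval_zero, ← h1, eval_finsetSum]
    refine Finset.sum_congr rfl fun i _ => ?_
    rw [eval_mul, eval_C, eval_pow, eval_X, ← map_pow, mul_comm (p.coeff i), ← Algebra.smul_def,
      map_smul, smul_eq_mul, mul_comm]
  by_cases hj : j ≤ p.natDegree
  · have := congrArg (fun r => coeff r j) hq
    simp only [q, finsetSum_coeff, coeff_C_mul_X_pow, coeff_zero] at this
    rw [Finset.sum_ite_eq, if_pos (Finset.mem_range.mpr (by omega))] at this
    exact this
  · rw [coeff_eq_zero_of_natDegree_lt (not_le.mp hj)]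
    simp

end SymmetricPower

/-! ### Matrix coefficients of the irreducible representations of `𝕊³` -/

section MatrixCoefficients

open Polynomial ComplexConjugate

/-- The first complex coordinate of `z + w j`. -/
noncomputable def zCoord : ℍ[ℝ] →ₗ[ℝ] ℂ where
  toFun x := ⟨x.re, x.imI⟩
  map_add' x y := by apply Complex.ext <;> simp
  map_smul' r x := by apply Complex.ext <;> simp

/-- The second complex coordinate of `z + w j`. -/
noncomputable def wCoord : ℍ[ℝ] →ₗ[ℝ] ℂ where
  toFun x := ⟨x.imJ, x.imK⟩
  map_add' x y := by apply Complex.ext <;> simp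
  map_smul' r x := by apply Complex.ext <;> simp

@[simp] theorem zCoord_re (x : ℍ[ℝ]) : (zCoord x).re = x.re := rfl
@[simp] theorem zCoord_im (x : ℍ[ℝ]) : (zCoord x).im = x.imI := rfl
@[simp] theorem wCoord_re (x : ℍ[ℝ]) : (wCoord x).re = x.imJ := rfl
@[simp] theorem wCoord_im (x : ℍ[ℝ]) : (wCoord x).im = x.imK := rfl

/-- The quaternion `z + wj` acts as the matrix with rows `(z, w)` and `(-w̄, z̄)`; this is an entry
of the product of two such matrices. -/
theorem zCoord_mul (x y : ℍ[ℝ]) :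
    zCoord (x * y) = zCoord x * zCoord y + wCoord x * -conj (wCoord y) := by
  apply Complex.ext
  · simp [Quaternion.re_mul]; ring
  · simp [Quaternion.imI_mul]; ring

theorem wCoord_mul (x y : ℍ[ℝ]) :
    wCoord (x * y) = zCoord x * wCoord y + wCoord x * conj (zCoord y) := by
  apply Complex.ext
  · simp [Quaternion.imJ_mul]; ring
  · simp [Quaternion.imK_mul]; ring

theorem coord_det (x : S3) : zCoord x * conj (zCoord x) - wCoord x * -conj (wCoord x) = 1 := by
  have h : Quaternion.normSq (x : ℍ[ℝ]) = 1 := by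
    rw [Quaternion.normSq_eq_norm_mul_self, norm_eq_of_mem_sphere, mul_one]
  rw [Quaternion.normSq_def'] at h
  apply Complex.ext
  · simp; linarith
  · simp; ring

noncomputable instance instRingContinuousMapS3 : Ring C(S3, ℂ) :=
  (inferInstance : CommRing C(S3, ℂ)).toRing

noncomputable instance instNonUnitalRingContinuousMapS3 : NonUnitalRing C(S3, ℂ) :=
  (inferInstance : CommRing C(S3, ℂ)).toNonUnitalCommRing.toNonUnitalRing

/-- The first complex coordinate as a continuous function on the sphere. -/
noncomputable def zFun : C(S3, ℂ) :=
  ⟨fun x => zCoord x, (LinearMap.continuous_of_finiteDimensional zCoord).comp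
    continuous_subtype_val⟩

/-- The second complex coordinate as a continuous function on the sphere. -/
noncomputable def wFun : C(S3, ℂ) :=
  ⟨fun x => wCoord x, (LinearMap.continuous_of_finiteDimensional wCoord).comp
    continuous_subtype_val⟩

@[simp] theorem zFun_apply (x : S3) : zFun x = zCoord x := rfl
@[simp] theorem wFun_apply (x : S3) : wFun x = wCoord x := rfl

theorem fun_det : zFun * star zFun - wFun * -star wFun = 1 := by
  ext x
  exact coord_det x

/-- The coefficients of the products `(z - w̄ X) ^ m * (w + z̄ X) ^ k`. -/
noncomputable def rawCoeff (m k j : ℕ) : C(S3, ℂ) :=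
  (colPoly zFun wFun (-star wFun) (star zFun) m k).coeff j

theorem rawCoeff_apply (m k j : ℕ) (x : S3) :
    rawCoeff m k j x =
      (colPoly (zCoord x) (wCoord x) (-conj (wCoord x)) (conj (zCoord x)) m k).coeff j := by
  have h := colPoly_map (ContinuousMap.evalStarAlgHom ℂ ℂ x : C(S3, ℂ) →+* ℂ)
    zFun wFun (-star wFun) (star zFun) m k
  have h2 := congrArg (fun p => p.coeff j) h
  rw [coeff_map] at h2
  simpa [rawCoeff] using h2

/-- The matrix coefficients of the unitary irreducible representation of dimension `l + 1`. -/
noncomputable def wigner (l j k : ℕ) : C(S3, ℂ) :=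
  (Real.sqrt (l.choose k / l.choose j) : ℂ) • rawCoeff (l - k) k j

theorem wigner_apply (l j k : ℕ) (x : S3) :
    wigner l j k x = (Real.sqrt (l.choose k / l.choose j) : ℂ) * rawCoeff (l - k) k j x := rfl

theorem choose_pos_real {l i : ℕ} (hi : i ≤ l) : (0 : ℝ) < l.choose i :=
  Nat.cast_pos.mpr (Nat.choose_pos hi)

theorem wigner_mul {l k : ℕ} (j : ℕ) (hk : k ≤ l) (x y : S3) :
    wigner l j k (x * y) =
      ∑ i ∈ Finset.range (l + 1), wigner l j i x * wigner l i k y := by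
  have h : rawCoeff (l - k) k j (x * y) =
      ∑ i ∈ Finset.range (l + 1), rawCoeff (l - i) i j x * rawCoeff (l - k) k i y := by
    simp only [rawCoeff_apply]
    rw [← coeff_colPoly_mul _ _ _ _ _ _ _ _ l k j hk]
    congr 2
    · exact zCoord_mul _ _
    · exact wCoord_mul _ _
    · rw [Metric.unitSphere.coe_mul, wCoord_mul]; simp
    · rw [Metric.unitSphere.coe_mul, zCoord_mul]; simp; ring
  rw [wigner_apply, h, Finset.mul_sum]
  refine Finset.sum_congr rfl fun i hi => ?_
  have hi' := choose_pos_real (Nat.lt_succ_iff.mp (Finset.mem_range.mp hi))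
  -- The normalising factor is a ratio of a column term to a row term, so it telescopes through the
  -- intermediate index.
  have hs : Real.sqrt (l.choose k / l.choose j : ℝ) =
      Real.sqrt (l.choose i / l.choose j) * Real.sqrt (l.choose k / l.choose i) := by
    rw [← Real.sqrt_mul (by positivity)]
    congr 1
    field_simp
  rw [wigner_apply, wigner_apply, hs]
  push_cast
  ring

/-- Inversion is conjugate transposition of the `2 × 2` matrix. The square roots of binomials are
chosen so that the weighted transposition symmetry `choose_mul_coeff_colPoly` becomes unitarity. -/
theorem wigner_inv {l j k : ℕ} (hj : j ≤ l) (hk : k ≤ l) (x : S3) :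
    wigner l j k x⁻¹ = conj (wigner l k j x) := by
  have hx : ((x⁻¹ : S3) : ℍ[ℝ]) = star (x : ℍ[ℝ]) := by
    have h1 : (x : ℍ[ℝ]) * star (x : ℍ[ℝ]) = 1 := by
      rw [Quaternion.self_mul_star, Quaternion.normSq_eq_norm_mul_self, norm_eq_of_mem_sphere]
      simp
    rw [Metric.unitSphere.coe_inv]
    exact inv_eq_of_mul_eq_one_right h1
  have hz : zCoord (star (x : ℍ[ℝ])) = conj (zCoord x) := by apply Complex.ext <;> simp
  have hw : wCoord (star (x : ℍ[ℝ])) = -wCoord x := by apply Complex.ext <;> simp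
  have h : (l.choose k : ℂ) * rawCoeff (l - k) k j x⁻¹ =
      (l.choose j : ℂ) * conj (rawCoeff (l - j) j k x) := by
    rw [rawCoeff_apply, rawCoeff_apply, hx, hz, hw, ← coeff_map, colPoly_map,
      choose_mul_coeff_colPoly]
    simp
  have hj' := choose_pos_real hj
  have hk' := choose_pos_real hk
  rw [wigner_apply, wigner_apply, map_mul, Complex.conj_ofReal]
  have hs : Real.sqrt (l.choose k / l.choose j : ℝ) =
      Real.sqrt (l.choose j / l.choose k) * (l.choose k / l.choose j) := by
    have e : (l.choose k / l.choose j : ℝ) =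
        (l.choose j / l.choose k) * (l.choose k / l.choose j) ^ 2 := by field_simp
    conv_lhs => rw [e, Real.sqrt_mul (by positivity), Real.sqrt_sq (by positivity)]
  rw [hs]
  have hj2 : (l.choose j : ℂ) ≠ 0 := by exact_mod_cast hj'.ne'
  push_cast
  field_simp
  linear_combination (Real.sqrt (l.choose j / l.choose k) : ℂ) * h

theorem wigner_one {l j : ℕ} (hj : j ≤ l) : wigner l j j 1 = 1 := by
  have h1 : zCoord ((1 : S3) : ℍ[ℝ]) = 1 := by apply Complex.ext <;> simp
  have h2 : wCoord ((1 : S3) : ℍ[ℝ]) = 0 := by apply Complex.ext <;> simp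
  rw [wigner_apply, rawCoeff_apply, h1, h2, div_self (choose_pos_real hj).ne']
  simp [colPoly]

/-- This is a diagonal entry of `D(x⁻¹) D(x) = 1`, where `D(x⁻¹)` is the adjoint of `D(x)`. -/
theorem sum_norm_wigner_sq {l k : ℕ} (hk : k ≤ l) (x : S3) :
    ∑ j ∈ Finset.range (l + 1), ‖wigner l j k x‖ ^ 2 = 1 := by
  have h := wigner_mul k hk x⁻¹ x
  rw [inv_mul_cancel, wigner_one hk] at h
  have h2 : ((∑ j ∈ Finset.range (l + 1), ‖wigner l j k x‖ ^ 2 : ℝ) : ℂ) = 1 := by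
    rw [h]
    push_cast
    refine Finset.sum_congr rfl fun i hi => ?_
    rw [wigner_inv hk (Nat.lt_succ_iff.mp (Finset.mem_range.mp hi)), Complex.conj_mul']
  exact_mod_cast h2

theorem norm_wigner_le_one {l j k : ℕ} (hj : j ≤ l) (hk : k ≤ l) (x : S3) :
    ‖wigner l j k x‖ ≤ 1 := by
  have h := sum_norm_wigner_sq hk x
  have h2 := Finset.single_le_sum (f := fun j => ‖wigner l j k x‖ ^ 2) (fun i _ => by positivity)
    (Finset.mem_range.mpr (Nat.lt_succ_of_le hj))
  rw [h] at h2
  exact (sq_le_one_iff₀ (norm_nonneg _)).mp h2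

/-- The matrix coefficients span a dense subspace of the continuous functions. -/
theorem dense_coeffSpan :
    (coeffSpan ℂ zFun wFun (-star wFun) (star zFun)).topologicalClosure = ⊤ := by
  set s : Set C(S3, ℂ) := {zFun, wFun, -star wFun, star zFun} with hs
  have hstar : ∀ f ∈ s, star f ∈ Algebra.adjoin ℂ s := by
    have H : ∀ f ∈ s, f ∈ Algebra.adjoin ℂ s := fun f hf => Algebra.subset_adjoin hf
    rintro f (rfl | rfl | rfl | rfl)
    · exact H _ (by simp [hs])
    · simpa using neg_mem (H (-star wFun) (by simp [hs]))
    · simpa using neg_mem (H wFun (by simp [hs]))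
    · simpa using H zFun (by simp [hs])
  -- The generators are permuted by conjugation up to sign, so the algebra they generate is already
  -- a star algebra and Stone–Weierstrass applies.
  let A : StarSubalgebra ℂ C(S3, ℂ) :=
    { Algebra.adjoin ℂ s with
      star_mem' := by
        intro f hf
        induction hf using Algebra.adjoin_induction with
        | mem x hx => exact hstar x hx
        | algebraMap r =>
          rw [← algebraMap_star_comm]; exact (Algebra.adjoin ℂ s).algebraMap_mem _
        | add x y _ _ hx hy => rw [star_add]; exact (Algebra.adjoin ℂ s).add_mem hx hy
        | mul x y _ _ hx hy => rw [star_mul]; exact (Algebra.adjoin ℂ s).mul_mem hy hx }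
  have hA : A.topologicalClosure = ⊤ := by
    refine ContinuousMap.starSubalgebra_topologicalClosure_eq_top_of_separatesPoints A ?_
    intro x y hxy
    by_contra hcon
    apply hxy
    have H : ∀ f ∈ s, f x = f y := by
      intro f hf
      by_contra hne
      exact hcon ⟨f, ⟨f, Algebra.subset_adjoin hf, rfl⟩, hne⟩
    have h1 : zCoord x = zCoord y := H zFun (by simp [hs])
    have h2 : wCoord x = wCoord y := H wFun (by simp [hs])
    apply Subtype.ext
    exact QuaternionAlgebra.ext (congrArg Complex.re h1) (congrArg Complex.im h1)
      (congrArg Complex.re h2) (congrArg Complex.im h2)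
  rw [eq_top_iff]
  intro f _
  have hf : f ∈ A.topologicalClosure := by rw [hA]; trivial
  rw [← SetLike.mem_coe, Submodule.topologicalClosure_coe]
  rw [← SetLike.mem_coe, StarSubalgebra.topologicalClosure_coe] at hf
  exact closure_mono (fun g hg => adjoin_le_coeffSpan fun_det hg) hf

end MatrixCoefficients

/-! ### Calculus of left-invariant derivatives -/

section LeftInvariant

open ComplexConjugate

theorem oneParam_zero (a : Fin 3) : oneParam a 0 = 1 := by
  apply Subtype.ext
  simp [oneParam]

theorem oneParam_coe (a : Fin 3) (t : ℝ) :
    (oneParam a t : ℍ[ℝ]) = NormedSpace.exp (t • imUnit a) := rfl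

theorem hasDerivAt_mul_oneParam (a : Fin 3) (x : S3) (t : ℝ) :
    HasDerivAt (fun t : ℝ => ((x * oneParam a t : S3) : ℍ[ℝ]))
      (((x * oneParam a t : S3) : ℍ[ℝ]) * imUnit a) t := by
  have h := (hasDerivAt_exp_smul_const (𝕂 := ℝ) (imUnit a) t).const_mul (x : ℍ[ℝ])
  rw [← mul_assoc] at h
  exact h

/-- Functions on the sphere that extend smoothly to the punctured space. -/
def HasSmoothExt (f : S3 → ℂ) : Prop :=
  ∃ F : ℍ[ℝ] → ℂ, ContDiffOn ℝ ∞ F {0}ᶜ ∧ ∀ x : S3, f x = F x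

theorem coe_mem_compl_zero (x : S3) : (x : ℍ[ℝ]) ∈ ({0}ᶜ : Set ℍ[ℝ]) :=
  ne_zero_of_mem_unit_sphere x

/-- The extension `q ↦ f(q/‖q‖)` works. It turns invariant derivatives into Fréchet derivatives on
an open set of a vector space, where they can be iterated. -/
theorem ContMDiff.hasSmoothExt {f : S3 → ℂ} (hf : ContMDiff (𝓡 3) 𝓘(ℝ, ℂ) ∞ f) :
    HasSmoothExt f := by
  classical
  let U : TopologicalSpace.Opens ℍ[ℝ] := ⟨{0}ᶜ, isOpen_compl_singleton⟩
  have hU : ∀ q : U, (q : ℍ[ℝ]) ≠ 0 := fun q => q.2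
  have hmem : ∀ q : U, ‖(q : ℍ[ℝ])‖⁻¹ • (q : ℍ[ℝ]) ∈ Metric.sphere (0 : ℍ[ℝ]) 1 := by
    intro q
    rw [mem_sphere_zero_iff_norm, norm_smul, norm_inv, norm_norm,
      inv_mul_cancel₀ (norm_ne_zero_iff.mpr (hU q))]
  have h1 : ContMDiff 𝓘(ℝ, ℍ[ℝ]) 𝓘(ℝ, ℍ[ℝ]) ∞
      (fun q : U => ‖(q : ℍ[ℝ])‖⁻¹ • (q : ℍ[ℝ])) := by
    intro q
    have : ContDiffAt ℝ ∞ (fun q : ℍ[ℝ] => ‖q‖⁻¹ • q) (q : ℍ[ℝ]) :=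
      ((contDiffAt_norm ℝ (hU q)).inv (norm_ne_zero_iff.mpr (hU q))).smul contDiffAt_id
    exact contMDiffAt_subtype_iff (f := fun q : ℍ[ℝ] => ‖q‖⁻¹ • q).mpr this.contMDiffAt
  have h2 := hf.comp (h1.codRestrict_sphere hmem)
  let F : ℍ[ℝ] → ℂ := fun q => if h : q ∈ U then f ⟨_, hmem ⟨q, h⟩⟩ else 0
  refine ⟨F, ?_, ?_⟩
  · intro q hq
    have h3 := h2 ⟨q, hq⟩
    have h4 : (f ∘ Set.codRestrict (fun q : U => ‖(q : ℍ[ℝ])‖⁻¹ • (q : ℍ[ℝ]))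
        (Metric.sphere 0 1) hmem) = fun q : U => F q := by
      funext q
      simp only [F, Function.comp_apply]
      rw [dif_pos q.2]
      rfl
    rw [h4, contMDiffAt_subtype_iff] at h3
    exact h3.contDiffAt.contDiffWithinAt
  · intro x
    have hx : (x : ℍ[ℝ]) ∈ U := coe_mem_compl_zero x
    simp only [F, dif_pos hx]
    congr 1
    apply Subtype.ext
    simp

theorem HasSmoothExt.continuous {f : S3 → ℂ} (hf : HasSmoothExt f) : Continuous f := by
  obtain ⟨F, hF, hfF⟩ := hf
  rw [funext hfF]
  exact hF.continuousOn.comp_continuous continuous_subtype_val coe_mem_compl_zero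

theorem HasSmoothExt.mul {f g : S3 → ℂ} (hf : HasSmoothExt f) (hg : HasSmoothExt g) :
    HasSmoothExt fun x => f x * g x := by
  obtain ⟨F, hF, hfF⟩ := hf
  obtain ⟨G, hG, hgG⟩ := hg
  exact ⟨_, hF.mul hG, fun x => by simp only [hfF, hgG]⟩

theorem HasSmoothExt.conj {f : S3 → ℂ} (hf : HasSmoothExt f) :
    HasSmoothExt fun x => conj (f x) := by
  obtain ⟨F, hF, hfF⟩ := hf
  exact ⟨fun q => Complex.conjCLE (F q), Complex.conjCLE.contDiff.comp_contDiffOn hF,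
    fun x => by simp only [hfF]; rfl⟩

theorem hasDerivAt_of_ext (a : Fin 3) {F : ℍ[ℝ] → ℂ} (hF : ContDiffOn ℝ ∞ F {0}ᶜ) (x : S3)
    (t : ℝ) : HasDerivAt (fun t : ℝ => F (x * oneParam a t : S3))
      (fderiv ℝ F (x * oneParam a t : S3) ((x * oneParam a t : S3) * imUnit a)) t := by
  have h1 := (hF.contDiffAt (isOpen_compl_singleton.mem_nhds
    (coe_mem_compl_zero (x * oneParam a t)))).differentiableAt (by simp)
  exact h1.hasFDerivAt.comp_hasDerivAt t (hasDerivAt_mul_oneParam a x t)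

theorem leftInvDeriv_of_ext (a : Fin 3) {f : S3 → ℂ} {F : ℍ[ℝ] → ℂ}
    (hF : ContDiffOn ℝ ∞ F {0}ᶜ) (hfF : ∀ x : S3, f x = F x) (x : S3) :
    leftInvDeriv a f x = fderiv ℝ F x (x * imUnit a) := by
  have h := (hasDerivAt_of_ext a hF x 0).deriv
  rw [oneParam_zero, mul_one] at h
  rw [leftInvDeriv, ← h]
  simp only [hfF]

theorem HasSmoothExt.hasDerivAt (a : Fin 3) {f : S3 → ℂ} (hf : HasSmoothExt f) (x : S3) (t : ℝ) :
    HasDerivAt (fun t : ℝ => f (x * oneParam a t)) (leftInvDeriv a f (x * oneParam a t)) t := by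
  obtain ⟨F, hF, hfF⟩ := hf
  rw [leftInvDeriv_of_ext a hF hfF]
  simp only [hfF]
  exact hasDerivAt_of_ext a hF x t

theorem HasSmoothExt.hasDerivAt_zero (a : Fin 3) {f : S3 → ℂ} (hf : HasSmoothExt f) (x : S3) :
    HasDerivAt (fun t : ℝ => f (x * oneParam a t)) (leftInvDeriv a f x) 0 := by
  have h := hf.hasDerivAt a x 0
  rwa [oneParam_zero, mul_one] at h

theorem HasSmoothExt.leftInvDeriv (a : Fin 3) {f : S3 → ℂ} (hf : HasSmoothExt f) :
    HasSmoothExt (leftInvDeriv a f) := by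
  obtain ⟨F, hF, hfF⟩ := hf
  refine ⟨fun q => fderiv ℝ F q (q * imUnit a), ?_, leftInvDeriv_of_ext a hF hfF⟩
  exact (hF.fderiv_of_isOpen isOpen_compl_singleton (by simp)).clm_apply
    (contDiff_id.mul contDiff_const).contDiffOn

theorem leftInvDeriv_mul (a : Fin 3) {f g : S3 → ℂ} (hf : HasSmoothExt f) (hg : HasSmoothExt g)
    (x : S3) : leftInvDeriv a (fun x => f x * g x) x =
      leftInvDeriv a f x * g x + f x * leftInvDeriv a g x := by
  have h := ((hf.hasDerivAt_zero a x).mul (hg.hasDerivAt_zero a x)).deriv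
  rw [oneParam_zero, mul_one] at h
  exact h

theorem leftInvDeriv_conj (a : Fin 3) {f : S3 → ℂ} (hf : HasSmoothExt f) (x : S3) :
    leftInvDeriv a (fun x => conj (f x)) x = conj (leftInvDeriv a f x) :=
  (Complex.conjCLE.toContinuousLinearMap.hasFDerivAt.comp_hasDerivAt _
    (hf.hasDerivAt_zero a x)).deriv

theorem leftInvDeriv_add (a : Fin 3) {f g : S3 → ℂ} (hf : HasSmoothExt f) (hg : HasSmoothExt g) :
    leftInvDeriv a (fun x => f x + g x) = fun x => leftInvDeriv a f x + leftInvDeriv a g x :=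
  funext fun x => ((hf.hasDerivAt_zero a x).add (hg.hasDerivAt_zero a x)).deriv

theorem leftInvDeriv_const_mul (a : Fin 3) (c : ℂ) {f : S3 → ℂ} (hf : HasSmoothExt f) :
    leftInvDeriv a (fun x => c * f x) = fun x => c * leftInvDeriv a f x :=
  funext fun x => ((hf.hasDerivAt_zero a x).const_mul c).deriv

end LeftInvariant

/-! ### Symmetry of the Laplacian -/

section Symmetry

open ComplexConjugate

variable (μ : Measure S3) [μ.IsHaarMeasure]

/-- Unimodularity of compact groups: a right translate of `μ` is a multiple of `μ` with the same
finite nonzero total mass. -/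
instance isMulRightInvariant_of_isHaarMeasure : μ.IsMulRightInvariant where
  map_mul_right_eq_self g := by
    have h := Measure.isMulInvariant_eq_smul_of_compactSpace (Measure.map (· * g) μ) μ
    have h2 := congrArg (fun ν : Measure S3 => ν Set.univ) h
    simp only [Measure.smul_apply] at h2
    rw [Measure.map_apply (measurable_mul_const g) MeasurableSet.univ, Set.preimage_univ] at h2
    rw [h]
    have h0 : μ Set.univ ≠ 0 := NeZero.ne _
    have ht : μ Set.univ ≠ ⊤ := measure_ne_top _ _
    have h3 : (Measure.haarScalarFactor (Measure.map (· * g) μ) μ : ℝ≥0∞) = 1 := by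
      rw [← ENNReal.mul_left_inj h0 ht, one_mul]
      exact h2.symm
    rw [ENNReal.coe_eq_one] at h3
    rw [h3, one_smul]

variable {μ}

theorem HasSmoothExt.integrable {f : S3 → ℂ} (hf : HasSmoothExt f) : Integrable f μ :=
  hf.continuous.integrable_of_hasCompactSupport (HasCompactSupport.of_compactSpace f)

/-- By right invariance, `∫ f(x exp(tv))` does not depend on `t`; differentiate under the integral
at `t = 0`. With the product rule this makes the invariant fields skew-symmetric. -/
theorem integral_leftInvDeriv (a : Fin 3) {f : S3 → ℂ} (hf : HasSmoothExt f) :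
    ∫ x, leftInvDeriv a f x ∂μ = 0 := by
  have hc := (hf.leftInvDeriv a).continuous
  obtain ⟨B, hB⟩ := isCompact_univ.exists_bound_of_continuousOn hc.continuousOn
  have hcont : ∀ t, Continuous fun x : S3 => f (x * oneParam a t) := fun t =>
    hf.continuous.comp (continuous_mul_const _)
  have h := (hasDerivAt_integral_of_dominated_loc_of_deriv_le (μ := μ) (𝕜 := ℝ)
    (F := fun t x => f (x * oneParam a t))
    (F' := fun t x => leftInvDeriv a f (x * oneParam a t)) (x₀ := 0) (s := Set.univ)
    (bound := fun _ => B) Filter.univ_mem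
    (Filter.Eventually.of_forall fun t => (hcont t).aestronglyMeasurable)
    ((hcont 0).integrable_of_hasCompactSupport (HasCompactSupport.of_compactSpace _))
    (hc.comp (continuous_mul_const _)).aestronglyMeasurable
    (Filter.Eventually.of_forall fun x t _ => hB _ (Set.mem_univ _))
    (integrable_const B)
    (Filter.Eventually.of_forall fun x t _ => hf.hasDerivAt a x t)).2
  simp only [integral_mul_right_eq_self (μ := μ) f] at h
  have h2 := h.unique (hasDerivAt_const 0 (∫ x, f x ∂μ))
  simpa [oneParam_zero] using h2

theorem integral_leftInvDeriv_mul_conj (a : Fin 3) {f g : S3 → ℂ} (hf : HasSmoothExt f)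
    (hg : HasSmoothExt g) :
    ∫ x, leftInvDeriv a f x * conj (g x) ∂μ = -∫ x, f x * conj (leftInvDeriv a g x) ∂μ := by
  have h := integral_leftInvDeriv (μ := μ) a (hf.mul hg.conj)
  simp only [leftInvDeriv_mul a hf hg.conj, leftInvDeriv_conj a hg] at h
  rw [integral_add ((hf.leftInvDeriv a).mul hg.conj).integrable
    (hf.mul (hg.leftInvDeriv a).conj).integrable] at h
  exact eq_neg_of_add_eq_zero_left h

/-- Functions on which an invariant derivative acts by different imaginary scalars are
orthogonal. -/
theorem integral_mul_conj_eq_zero_of_leftInvDeriv (a : Fin 3) {f g : S3 → ℂ}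
    (hf : HasSmoothExt f) (hg : HasSmoothExt g) {s t : ℝ} (hst : s ≠ t)
    (h1 : ∀ x, leftInvDeriv a f x = (Complex.I * s) * f x)
    (h2 : ∀ x, leftInvDeriv a g x = (Complex.I * t) * g x) :
    ∫ x, f x * conj (g x) ∂μ = 0 := by
  have h := integral_leftInvDeriv_mul_conj (μ := μ) a hf hg
  simp only [h1, h2, map_mul, Complex.conj_I, Complex.conj_ofReal] at h
  simp_rw [mul_assoc (Complex.I * (s : ℂ)), mul_left_comm _ (-Complex.I * (t : ℂ))] at h
  rw [integral_const_mul, integral_const_mul] at h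
  have h3 : (Complex.I * ((s : ℂ) - t)) * ∫ x, f x * conj (g x) ∂μ = 0 := by
    linear_combination h
  refine (mul_eq_zero.mp h3).resolve_left (mul_ne_zero Complex.I_ne_zero (sub_ne_zero.mpr ?_))
  exact_mod_cast hst

theorem integral_leftInvDeriv_sq_mul_conj (a : Fin 3) {f g : S3 → ℂ} (hf : HasSmoothExt f)
    (hg : HasSmoothExt g) :
    ∫ x, leftInvDeriv a (leftInvDeriv a f) x * conj (g x) ∂μ =
      ∫ x, f x * conj (leftInvDeriv a (leftInvDeriv a g) x) ∂μ := by
  rw [integral_leftInvDeriv_mul_conj a (hf.leftInvDeriv a) hg,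
    integral_leftInvDeriv_mul_conj a hf (hg.leftInvDeriv a), neg_neg]

theorem integral_sphereLaplacian_mul_conj {f g : S3 → ℂ} (hf : HasSmoothExt f)
    (hg : HasSmoothExt g) :
    ∫ x, sphereLaplacian f x * conj (g x) ∂μ = ∫ x, f x * conj (sphereLaplacian g x) ∂μ := by
  simp only [sphereLaplacian, Finset.sum_mul, map_sum, Finset.mul_sum]
  rw [integral_finsetSum, integral_finsetSum]
  · exact Finset.sum_congr rfl fun a _ => integral_leftInvDeriv_sq_mul_conj a hf hg
  · exact fun a _ => (hf.mul ((hg.leftInvDeriv a).leftInvDeriv a).conj).integrable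
  · exact fun a _ => (((hf.leftInvDeriv a).leftInvDeriv a).mul hg.conj).integrable

/-- Eigenfunctions of the Laplacian for different eigenvalues are orthogonal. -/
theorem integral_mul_conj_eq_zero_of_sphereLaplacian {f g : S3 → ℂ}
    (hf : HasSmoothExt f) (hg : HasSmoothExt g) {s t : ℝ} (hst : s ≠ t)
    (h1 : ∀ x, sphereLaplacian f x = -(s * f x)) (h2 : ∀ x, sphereLaplacian g x = -(t * g x)) :
    ∫ x, f x * conj (g x) ∂μ = 0 := by
  have h := integral_sphereLaplacian_mul_conj (μ := μ) hf hg
  simp only [h1, h2, map_mul, map_neg, Complex.conj_ofReal, neg_mul, mul_neg] at h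
  simp_rw [mul_assoc (s : ℂ), mul_left_comm _ (t : ℂ)] at h
  rw [integral_neg, integral_neg, integral_const_mul, integral_const_mul] at h
  have h3 : ((s : ℂ) - t) * ∫ x, f x * conj (g x) ∂μ = 0 := by
    linear_combination -h
  refine (mul_eq_zero.mp h3).resolve_left (sub_ne_zero.mpr ?_)
  exact_mod_cast hst

end Symmetry

/-! ### The matrix coefficients are eigenfunctions of the Laplacian -/

section Eigenfunctions

open ComplexConjugate Polynomial

/-- The real linear form `z - ξ w̄`. -/
noncomputable def pForm (ξ : ℂ) : ℍ[ℝ] →ₗ[ℝ] ℂ where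
  toFun x := zCoord x - ξ * conj (wCoord x)
  map_add' x y := by simp only [map_add]; ring
  map_smul' r x := by
    simp only [map_smul, Complex.real_smul, map_mul, Complex.conj_ofReal, RingHom.id_apply]; ring

/-- The real linear form `w + ξ z̄`. -/
noncomputable def qForm (ξ : ℂ) : ℍ[ℝ] →ₗ[ℝ] ℂ where
  toFun x := wCoord x + ξ * conj (zCoord x)
  map_add' x y := by simp only [map_add]; ring
  map_smul' r x := by
    simp only [map_smul, Complex.real_smul, map_mul, Complex.conj_ofReal, RingHom.id_apply]; ring

theorem pForm_apply (ξ : ℂ) (x : ℍ[ℝ]) : pForm ξ x = zCoord x - ξ * conj (wCoord x) := rfl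

theorem qForm_apply (ξ : ℂ) (x : ℍ[ℝ]) : qForm ξ x = wCoord x + ξ * conj (zCoord x) := rfl

theorem zCoord_imUnit : (fun a => zCoord (imUnit a)) = ![Complex.I, 0, 0] := by
  funext a; fin_cases a <;> apply Complex.ext <;> simp [imUnit] <;> rfl

theorem wCoord_imUnit : (fun a => wCoord (imUnit a)) = ![0, 1, Complex.I] := by
  funext a; fin_cases a <;> apply Complex.ext <;> simp [imUnit] <;> rfl

/-- For fixed `ξ`, the forms `p` and `q` span a copy of the two-dimensional representation, stable
under the three fields. -/
theorem pForm_mul_imUnit (ξ : ℂ) (x : ℍ[ℝ]) : (fun a => pForm ξ (x * imUnit a)) =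
    ![Complex.I * pForm ξ x, -qForm ξ x, Complex.I * qForm ξ x] := by
  have hz := fun a => congrFun zCoord_imUnit a
  have hw := fun a => congrFun wCoord_imUnit a
  funext a
  simp only [pForm_apply, qForm_apply, zCoord_mul, wCoord_mul, hz, hw]
  fin_cases a <;> simp <;> ring

theorem qForm_mul_imUnit (ξ : ℂ) (x : ℍ[ℝ]) : (fun a => qForm ξ (x * imUnit a)) =
    ![-(Complex.I * qForm ξ x), pForm ξ x, Complex.I * pForm ξ x] := by
  have hz := fun a => congrFun zCoord_imUnit a
  have hw := fun a => congrFun wCoord_imUnit a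
  funext a
  simp only [pForm_apply, qForm_apply, zCoord_mul, wCoord_mul, hz, hw]
  fin_cases a <;> simp <;> ring

theorem hasDerivAt_linear (P : ℍ[ℝ] →ₗ[ℝ] ℂ) (a : Fin 3) (x : S3) :
    HasDerivAt (fun t : ℝ => P ((x * oneParam a t : S3) : ℍ[ℝ])) (P (x * imUnit a)) 0 := by
  have h := (LinearMap.toContinuousLinearMap P).hasFDerivAt.comp_hasDerivAt 0
    (hasDerivAt_mul_oneParam a x 0)
  rw [oneParam_zero, mul_one] at h
  exact h

/-- The function `p ^ m * q ^ k` on the sphere. -/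
noncomputable def formPow (ξ : ℂ) (m k : ℕ) (x : S3) : ℂ := pForm ξ x ^ m * qForm ξ x ^ k

theorem contDiff_linear (P : ℍ[ℝ] →ₗ[ℝ] ℂ) : ContDiff ℝ ∞ fun x => P x :=
  (LinearMap.toContinuousLinearMap P).contDiff

theorem contMDiff_formPow (ξ : ℂ) (m k : ℕ) : ContMDiff (𝓡 3) 𝓘(ℝ, ℂ) ∞ (formPow ξ m k) :=
  (((contDiff_linear (pForm ξ)).pow m).mul ((contDiff_linear (qForm ξ)).pow k)).contMDiff.comp
    contMDiff_coe_sphere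

theorem leftInvDeriv_formPow (ξ : ℂ) (m k : ℕ) (a : Fin 3) (x : S3) :
    leftInvDeriv a (formPow ξ m k) x =
      m * pForm ξ x ^ (m - 1) * pForm ξ (x * imUnit a) * qForm ξ x ^ k +
        pForm ξ x ^ m * (k * qForm ξ x ^ (k - 1) * qForm ξ (x * imUnit a)) := by
  have h := (((hasDerivAt_linear (pForm ξ) a x).pow m).mul
    ((hasDerivAt_linear (qForm ξ) a x).pow k)).deriv
  simp only [Pi.pow_apply, oneParam_zero, mul_one] at h
  exact h

theorem leftInvDeriv_formPow_zero (ξ : ℂ) (m k : ℕ) :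
    leftInvDeriv 0 (formPow ξ m k) =
      fun x => (Complex.I * ((m : ℝ) - k : ℝ)) * formPow ξ m k x := by
  funext x
  have hp := congrFun (pForm_mul_imUnit ξ x) 0
  have hq := congrFun (qForm_mul_imUnit ξ x) 0
  simp only [Matrix.cons_val_zero] at hp hq
  rw [leftInvDeriv_formPow, hp, hq]
  simp only [formPow]
  rcases m with _ | m <;> rcases k with _ | k <;> simp <;> ring

/-- Truncated subtraction is harmless: a term with exponent `k - 1` or `m - 1` carries the factor
`k` or `m`. -/
theorem leftInvDeriv_formPow_one (ξ : ℂ) (m k : ℕ) :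
    leftInvDeriv 1 (formPow ξ m k) =
      fun x => k * formPow ξ (m + 1) (k - 1) x + -m * formPow ξ (m - 1) (k + 1) x := by
  funext x
  have hp := congrFun (pForm_mul_imUnit ξ x) 1
  have hq := congrFun (qForm_mul_imUnit ξ x) 1
  simp only [Matrix.cons_val_one, Matrix.cons_val_zero] at hp hq
  rw [leftInvDeriv_formPow, hp, hq]
  simp only [formPow]
  ring

theorem leftInvDeriv_formPow_two (ξ : ℂ) (m k : ℕ) :
    leftInvDeriv 2 (formPow ξ m k) =
      fun x => (Complex.I * k) * formPow ξ (m + 1) (k - 1) x +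
        (Complex.I * m) * formPow ξ (m - 1) (k + 1) x := by
  funext x
  have hp := congrFun (pForm_mul_imUnit ξ x) 2
  have hq := congrFun (qForm_mul_imUnit ξ x) 2
  simp only [Matrix.cons_val] at hp hq
  rw [leftInvDeriv_formPow, hp, hq]
  simp only [formPow]
  ring

theorem HasSmoothExt.const_mul (c : ℂ) {f : S3 → ℂ} (hf : HasSmoothExt f) :
    HasSmoothExt fun x => c * f x := by
  obtain ⟨F, hF, hfF⟩ := hf
  exact ⟨fun q => c * F q, contDiffOn_const.mul hF, fun x => by simp only [hfF]⟩

/-- In the squares of the fields of `j` and `k`, the terms that shift the exponents by two cancel.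
The diagonal terms add up to `-(m-k)² - 2(2mk + m + k) = -(m+k)(m+k+2)`. -/
theorem sphereLaplacian_formPow (ξ : ℂ) (m k : ℕ) (x : S3) :
    sphereLaplacian (formPow ξ m k) x =
      -((((m + k : ℕ) : ℝ) * ((m + k : ℕ) + 2) : ℝ) * formPow ξ m k x) := by
  have hs : ∀ m k, HasSmoothExt (formPow ξ m k) := fun m k => (contMDiff_formPow ξ m k).hasSmoothExt
  have h0 : leftInvDeriv 0 (leftInvDeriv 0 (formPow ξ m k)) x = -((m : ℂ) - k) ^ 2 *
      formPow ξ m k x := by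
    rw [leftInvDeriv_formPow_zero, leftInvDeriv_const_mul 0 _ (hs _ _), leftInvDeriv_formPow_zero]
    push_cast
    linear_combination (((m : ℂ) - k) ^ 2 * formPow ξ m k x) * Complex.I_sq
  have h1 : leftInvDeriv 1 (leftInvDeriv 1 (formPow ξ m k)) x =
      k * leftInvDeriv 1 (formPow ξ (m + 1) (k - 1)) x +
        -m * leftInvDeriv 1 (formPow ξ (m - 1) (k + 1)) x := by
    rw [leftInvDeriv_formPow_one ξ m k, leftInvDeriv_add 1 ((hs _ _).const_mul _)
      ((hs _ _).const_mul _), leftInvDeriv_const_mul 1 _ (hs _ _),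
      leftInvDeriv_const_mul 1 _ (hs _ _)]
  have h2 : leftInvDeriv 2 (leftInvDeriv 2 (formPow ξ m k)) x =
      (Complex.I * k) * leftInvDeriv 2 (formPow ξ (m + 1) (k - 1)) x +
        (Complex.I * m) * leftInvDeriv 2 (formPow ξ (m - 1) (k + 1)) x := by
    rw [leftInvDeriv_formPow_two ξ m k, leftInvDeriv_add 2 ((hs _ _).const_mul _)
      ((hs _ _).const_mul _), leftInvDeriv_const_mul 2 _ (hs _ _),
      leftInvDeriv_const_mul 2 _ (hs _ _)]
  rw [sphereLaplacian, Fin.sum_univ_three, h0, h1, h2]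
  simp only [leftInvDeriv_formPow_one, leftInvDeriv_formPow_two]
  rcases m with _ | m <;> rcases k with _ | k <;>
    simp only [Nat.cast_zero, Nat.add_sub_cancel, Nat.cast_add, Nat.cast_one, Complex.ofReal_add,
      Complex.ofReal_mul, Complex.ofReal_natCast, Complex.ofReal_ofNat, Complex.ofReal_one,
      Complex.ofReal_zero] <;>
    ring_nf <;> simp only [Complex.I_sq] <;> ring

/-- The smooth functions on which the Laplacian acts by `-(l (l + 2))`, `l = m + k`, and the first
left-invariant derivative by `i (m - k)`. -/
noncomputable def weightSpace (m k : ℕ) : Submodule ℂ C(S3, ℂ) where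
  carrier := {f | ContMDiff (𝓡 3) 𝓘(ℝ, ℂ) ∞ f ∧
    (∀ x, leftInvDeriv 0 f x = (Complex.I * ((m : ℝ) - k : ℝ)) * f x) ∧
    ∀ x, sphereLaplacian f x = -((((m + k : ℕ) : ℝ) * ((m + k : ℕ) + 2) : ℝ) * f x)}
  add_mem' := by
    rintro f g ⟨hf, hf1, hf2⟩ ⟨hg, hg1, hg2⟩
    have hf' := hf.hasSmoothExt
    have hg' := hg.hasSmoothExt
    refine ⟨(contDiff_fst.add contDiff_snd).contMDiff.comp (hf.prodMk_space hg), fun x => ?_,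
      fun x => ?_⟩
    · exact (congrFun (leftInvDeriv_add 0 hf' hg') x).trans (by
        rw [hf1, hg1, ContinuousMap.add_apply, mul_add])
    · have h : sphereLaplacian (f + g : C(S3, ℂ)) x = sphereLaplacian f x + sphereLaplacian g x := by
        simp only [sphereLaplacian, ← Finset.sum_add_distrib]
        refine Finset.sum_congr rfl fun a _ => ?_
        rw [ContinuousMap.coe_add, show (⇑f + ⇑g) = fun x => f x + g x from rfl,
          leftInvDeriv_add a hf' hg', leftInvDeriv_add a (hf'.leftInvDeriv a) (hg'.leftInvDeriv a)]
      rw [h, hf2, hg2, ContinuousMap.add_apply]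
      ring
  zero_mem' := by
    have h : ∀ a, leftInvDeriv a (fun _ => 0) = fun _ => 0 := fun a => by
      funext x; simp [leftInvDeriv]
    refine ⟨contMDiff_const, fun x => ?_, fun x => ?_⟩
    · exact (congrFun (h 0) x).trans (by simp)
    · have : sphereLaplacian (0 : C(S3, ℂ)) x = 0 := by
        simp only [sphereLaplacian, ContinuousMap.coe_zero]
        refine Finset.sum_eq_zero fun a _ => ?_
        rw [show (0 : S3 → ℂ) = fun _ => 0 from rfl, h, h]
      rw [this]
      simp
  smul_mem' := by
    rintro c f ⟨hf, hf1, hf2⟩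
    have hf' := hf.hasSmoothExt
    refine ⟨(contDiff_const.mul contDiff_id).contMDiff.comp hf, fun x => ?_,
      fun x => ?_⟩
    · exact (congrFun (leftInvDeriv_const_mul 0 c hf') x).trans (by
        rw [hf1, ContinuousMap.smul_apply, smul_eq_mul, mul_left_comm])
    · have h : sphereLaplacian (c • f : C(S3, ℂ)) x = c * sphereLaplacian f x := by
        simp only [sphereLaplacian, Finset.mul_sum]
        refine Finset.sum_congr rfl fun a _ => ?_
        rw [ContinuousMap.coe_smul, show (c • ⇑f) = fun x => c * f x from rfl,
          leftInvDeriv_const_mul a c hf', leftInvDeriv_const_mul a c (hf'.leftInvDeriv a)]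
      rw [h, hf2, ContinuousMap.smul_apply, smul_eq_mul]
      ring

/-- At every scalar `ξ` the generating polynomial takes the value `p^m q^k`, which lies in the
weight space; hence so do its coefficients. -/
theorem rawCoeff_mem_weightSpace (m k j : ℕ) : rawCoeff m k j ∈ weightSpace m k := by
  refine coeff_mem_of_eval_mem _ _ (fun ξ => ?_) j
  have h : ⇑((colPoly zFun wFun (-star wFun) (star zFun) m k).eval (algebraMap ℂ C(S3, ℂ) ξ)) =
      formPow ξ m k := by
    funext x
    rw [colPoly, eval_mul, eval_pow, eval_pow, eval_add, eval_add, eval_mul, eval_mul, eval_C,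
      eval_C, eval_C, eval_C, eval_X, formPow, pForm_apply, qForm_apply, sub_eq_add_neg,
      ← mul_neg, mul_comm ξ, mul_comm ξ]
    rfl
  refine ⟨?_, ?_, ?_⟩
  · rw [h]; exact contMDiff_formPow ξ m k
  · rw [h]; exact fun x => congrFun (leftInvDeriv_formPow_zero ξ m k) x
  · rw [h]; exact sphereLaplacian_formPow ξ m k

theorem wigner_mem_weightSpace (l j k : ℕ) : wigner l j k ∈ weightSpace (l - k) k :=
  Submodule.smul_mem _ _ (rawCoeff_mem_weightSpace _ _ _)

theorem contMDiff_wigner (l j k : ℕ) : ContMDiff (𝓡 3) 𝓘(ℝ, ℂ) ∞ (wigner l j k) :=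
  (wigner_mem_weightSpace l j k).1

theorem sphereLaplacian_wigner {l k : ℕ} (j : ℕ) (hk : k ≤ l) (x : S3) :
    sphereLaplacian (wigner l j k) x = -(((l : ℝ) * (l + 2) : ℝ) * wigner l j k x) := by
  have h := (wigner_mem_weightSpace l j k).2.2 x
  rwa [Nat.sub_add_cancel hk] at h

end Eigenfunctions

/-! ### Orthogonality relations -/

section Orthogonality

open ComplexConjugate Polynomial

variable {μ : Measure S3} [μ.IsHaarMeasure]

theorem integrable_mul_conj (f g : C(S3, ℂ)) : Integrable (fun x => f x * conj (g x)) μ :=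
  (f.continuous.mul (Complex.continuous_conj.comp g.continuous)).integrable_of_hasCompactSupport
    (HasCompactSupport.of_compactSpace _)

theorem integral_wigner_of_ne_degree {l l' k k' : ℕ} (j j' : ℕ) (hk : k ≤ l) (hk' : k' ≤ l')
    (h : l ≠ l') : ∫ x, wigner l j k x * conj (wigner l' j' k' x) ∂μ = 0 := by
  refine integral_mul_conj_eq_zero_of_sphereLaplacian (contMDiff_wigner l j k).hasSmoothExt
    (contMDiff_wigner l' j' k').hasSmoothExt (fun hcon => h ?_) (sphereLaplacian_wigner j hk)
    (sphereLaplacian_wigner j' hk')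
  have h2 : l * (l + 2) = l' * (l' + 2) := by exact_mod_cast hcon
  nlinarith [h2]

/-- The field of `i` acts on column `k` by `i(l - 2k)`, and these weights are distinct. -/
theorem integral_wigner_of_ne_right {l k k' : ℕ} (j j' : ℕ) (hk : k ≤ l) (hk' : k' ≤ l)
    (h : k ≠ k') : ∫ x, wigner l j k x * conj (wigner l j' k' x) ∂μ = 0 := by
  refine integral_mul_conj_eq_zero_of_leftInvDeriv 0 (contMDiff_wigner l j k).hasSmoothExt
    (contMDiff_wigner l j' k').hasSmoothExt (fun hcon => h ?_)
    (wigner_mem_weightSpace l j k).2.1 (wigner_mem_weightSpace l j' k').2.1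
  rw [Nat.cast_sub hk, Nat.cast_sub hk'] at hcon
  have : (k : ℝ) = k' := by linarith
  exact_mod_cast this

theorem mem_sphere_of_sum_sq (q : ℍ[ℝ]) (h : q.re ^ 2 + q.imI ^ 2 + q.imJ ^ 2 + q.imK ^ 2 = 1) :
    q ∈ Metric.sphere (0 : ℍ[ℝ]) 1 := by
  rw [← Quaternion.normSq_def', Quaternion.normSq_eq_norm_mul_self] at h
  rw [mem_sphere_zero_iff_norm]
  nlinarith [norm_nonneg q]

/-- The point of the sphere with given coordinates. -/
noncomputable def spherePoint (a b c d : ℝ) (h : a ^ 2 + b ^ 2 + c ^ 2 + d ^ 2 = 1) : S3 :=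
  ⟨⟨a, b, c, d⟩, mem_sphere_of_sum_sq _ h⟩

/-- The element `e ^ {iθ}` of the maximal torus. -/
noncomputable def torus (θ : ℝ) : S3 :=
  spherePoint (Real.cos θ) (Real.sin θ) 0 0 (by simp)

theorem zCoord_torus (θ : ℝ) : zCoord (torus θ) = Complex.exp (θ * Complex.I) := by
  rw [Complex.exp_mul_I, ← Complex.ofReal_cos, ← Complex.ofReal_sin]
  apply Complex.ext
  · simp [torus, spherePoint]; rfl
  · simp [torus, spherePoint]; rfl

theorem wCoord_torus (θ : ℝ) : wCoord (torus θ) = 0 := by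
  apply Complex.ext <;> rfl

/-- Torus elements are represented by diagonal matrices, so left translation scales row `j` by
`e^(iθ(l-2j))`. -/
theorem wigner_torus_mul {l j k : ℕ} (hj : j ≤ l) (hk : k ≤ l) (θ : ℝ) (x : S3) :
    wigner l j k (torus θ * x) =
      Complex.exp (θ * Complex.I) ^ (l - j) * conj (Complex.exp (θ * Complex.I)) ^ j *
        wigner l j k x := by
  rw [wigner_mul j hk, Finset.sum_eq_single j]
  · rw [wigner_apply l j j, rawCoeff_apply, zCoord_torus, wCoord_torus,
      div_self (choose_pos_real hj).ne', Real.sqrt_one]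
    congr 1
    have : colPoly (Complex.exp (θ * Complex.I)) 0 (-conj 0) (conj (Complex.exp (θ * Complex.I)))
        (l - j) j = C (Complex.exp (θ * Complex.I) ^ (l - j) *
          conj (Complex.exp (θ * Complex.I)) ^ j) * X ^ j := by
      simp [colPoly]; ring
    rw [this, coeff_C_mul_X_pow]
    simp
  · intro i _ hij
    rw [wigner_apply l j i, rawCoeff_apply, zCoord_torus, wCoord_torus]
    have : colPoly (Complex.exp (θ * Complex.I)) 0 (-conj 0) (conj (Complex.exp (θ * Complex.I)))
        (l - i) i = C (Complex.exp (θ * Complex.I) ^ (l - i) *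
          conj (Complex.exp (θ * Complex.I)) ^ i) * X ^ i := by
      simp [colPoly]; ring
    rw [this, coeff_C_mul_X_pow, if_neg hij.symm]
    simp
  · intro h
    exact absurd (Finset.mem_range.mpr (Nat.lt_succ_of_le hj)) h

theorem integral_wigner_of_lt_left {l j j' k : ℕ} (hj' : j' ≤ l) (hk : k ≤ l) (h : j < j') :
    ∫ x, wigner l j k x * conj (wigner l j' k x) ∂μ = 0 := by
  obtain ⟨n, rfl⟩ := Nat.exists_eq_add_of_lt h
  obtain ⟨s, rfl⟩ := Nat.exists_eq_add_of_le hj'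
  set l := j + n + 1 + s with hl
  -- Here `j' - j = n + 1`, and translation multiplies the integrand by `e^(2iθ(n+1))`. This `θ`
  -- makes the factor `-1`, so the integral equals its own negative.
  set θ : ℝ := Real.pi / (2 * (n + 1)) with hθ
  set e := Complex.exp (θ * Complex.I) with he
  have h1 : e * conj e = 1 := by
    rw [Complex.mul_conj, Complex.normSq_eq_norm_sq, he, Complex.norm_exp_ofReal_mul_I]
    simp
  have h2 : e ^ (2 * (n + 1)) = -1 := by
    rw [he, ← Complex.exp_nat_mul, ← Complex.exp_pi_mul_I]
    congr 1
    rw [hθ]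
    push_cast
    field_simp
  have h3 := integral_mul_left_eq_self (μ := μ)
    (fun x => wigner l j k x * conj (wigner l (j + n + 1) k x)) (torus θ)
  simp only [wigner_torus_mul (hj'.trans' (by omega : j ≤ j + n + 1)) hk,
    wigner_torus_mul hj' hk] at h3
  have h4 : ∀ x, e ^ (l - j) * conj e ^ j * wigner l j k x *
      conj (e ^ (l - (j + n + 1)) * conj e ^ (j + n + 1) * wigner l (j + n + 1) k x) =
      -1 * (wigner l j k x * conj (wigner l (j + n + 1) k x)) := by
    intro x
    have h5 : e ^ (l - j) * conj e ^ j * (conj e ^ (l - (j + n + 1)) * e ^ (j + n + 1)) =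
        -1 := by
      rw [show l - j = n + 1 + s by omega, show l - (j + n + 1) = s by omega]
      calc e ^ (n + 1 + s) * conj e ^ j * (conj e ^ s * e ^ (j + n + 1))
          = (e * conj e) ^ (j + s) * e ^ (2 * (n + 1)) := by ring
        _ = -1 := by rw [h1, h2]; simp
    rw [← h5]
    simp only [map_mul, map_pow, Complex.conj_conj]
    ring
  simp only [← he, h4] at h3
  rw [integral_const_mul] at h3
  linear_combination (-1 / 2 : ℂ) * h3

theorem integral_wigner_of_ne_left {l j j' k : ℕ} (hj : j ≤ l) (hj' : j' ≤ l) (hk : k ≤ l)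
    (h : j ≠ j') : ∫ x, wigner l j k x * conj (wigner l j' k x) ∂μ = 0 := by
  rcases lt_or_gt_of_ne h with h | h
  · exact integral_wigner_of_lt_left hj' hk h
  · have h2 := congrArg conj (integral_wigner_of_lt_left (μ := μ) hj hk h)
    rw [← integral_conj, map_zero] at h2
    simpa [mul_comm] using h2

/-- A point of the sphere whose matrix has nonzero first column. -/
noncomputable def obliquePoint : S3 := spherePoint (3 / 5) 0 (4 / 5) 0 (by norm_num)

/-- Column `0` consists of nonzero multiples of the coefficients of `(3/5 - 4/5 X)^l`, none of which
vanishes. This allows cancellation in `integral_wigner_mul_left`. -/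
theorem wigner_obliquePoint_ne_zero {l j : ℕ} (hj : j ≤ l) : wigner l j 0 obliquePoint ≠ 0 := by
  have hz : zCoord obliquePoint = (3 / 5 : ℝ) := by apply Complex.ext <;> rfl
  have hw : wCoord obliquePoint = (4 / 5 : ℝ) := by apply Complex.ext <;> rfl
  have hc := choose_pos_real hj
  rw [wigner_apply, rawCoeff_apply, hz, hw]
  refine mul_ne_zero ?_ ?_
  · rw [Complex.ofReal_ne_zero]
    simp only [Nat.choose_zero_right, Nat.cast_one]
    positivity
  · have : (colPoly ((3 / 5 : ℝ) : ℂ) ((4 / 5 : ℝ) : ℂ) (-conj ((4 / 5 : ℝ) : ℂ))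
        (conj ((3 / 5 : ℝ) : ℂ)) (l - 0) 0).coeff j =
        (l.choose j : ℂ) * ((3 / 5 : ℂ) ^ (l - j) * (-(4 / 5) : ℂ) ^ j) := by
      rw [colPoly, pow_zero, mul_one, Nat.sub_zero, coeff_add_mul_X_pow, Complex.conj_ofReal]
      norm_num
    rw [this]
    refine mul_ne_zero (by exact_mod_cast hc.ne') (mul_ne_zero ?_ ?_) <;>
      exact pow_ne_zero _ (by norm_num)

/-- Schur's argument: the integral of `D_jk(gx)` against `D_ik(x)` is computed by expanding the
first factor, or by translating and expanding the second. Row orthogonality leaves one term each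
time. -/
theorem integral_wigner_mul_left {l j i k : ℕ} (hj : j ≤ l) (hi : i ≤ l) (hk : k ≤ l) (g : S3) :
    wigner l j i g * ∫ x, wigner l i k x * conj (wigner l i k x) ∂μ =
      wigner l j i g * ∫ x, wigner l j k x * conj (wigner l j k x) ∂μ := by
  have h1 : ∫ x, wigner l j k (g * x) * conj (wigner l i k x) ∂μ =
      wigner l j i g * ∫ x, wigner l i k x * conj (wigner l i k x) ∂μ := by
    simp only [wigner_mul j hk, Finset.sum_mul, mul_assoc]
    rw [integral_finsetSum _ fun n _ => (integrable_mul_conj _ _).const_mul _]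
    simp only [integral_const_mul]
    rw [Finset.sum_eq_single i]
    · intro n hn hni
      rw [integral_wigner_of_ne_left (Nat.lt_succ_iff.mp (Finset.mem_range.mp hn)) hi hk hni,
        mul_zero]
    · exact fun h => absurd (Finset.mem_range.mpr (Nat.lt_succ_of_le hi)) h
  have h2 : ∫ x, wigner l j k x * conj (wigner l i k (g⁻¹ * x)) ∂μ =
      wigner l j i g * ∫ x, wigner l j k x * conj (wigner l j k x) ∂μ := by
    simp only [wigner_mul i hk, map_sum, map_mul, Finset.mul_sum, mul_left_comm _ (conj _)]
    rw [integral_finsetSum _ fun n _ => (integrable_mul_conj _ _).const_mul _]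
    simp only [integral_const_mul]
    rw [Finset.sum_eq_single j]
    · rw [wigner_inv hi hj, Complex.conj_conj]
    · intro n hn hnj
      rw [integral_wigner_of_ne_left hj (Nat.lt_succ_iff.mp (Finset.mem_range.mp hn)) hk
        hnj.symm, mul_zero]
    · exact fun h => absurd (Finset.mem_range.mpr (Nat.lt_succ_of_le hj)) h
  rw [← h1, ← h2, ← integral_mul_left_eq_self
    (fun x => wigner l j k x * conj (wigner l i k (g⁻¹ * x))) g]
  simp only [inv_mul_cancel_left]

/-- The `l + 1` entries of a column have equal square integrals, and by unitarity these add up to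
the total mass. -/
theorem integral_wigner_self {l j k : ℕ} (hj : j ≤ l) (hk : k ≤ l) :
    ∫ x, wigner l j k x * conj (wigner l j k x) ∂μ = ((μ.real Set.univ / (l + 1) : ℝ) : ℂ) := by
  have h1 : ∀ i ∈ Finset.range (l + 1), ∫ x, wigner l i k x * conj (wigner l i k x) ∂μ =
      ∫ x, wigner l 0 k x * conj (wigner l 0 k x) ∂μ := by
    intro i hi
    have hi' := Nat.lt_succ_iff.mp (Finset.mem_range.mp hi)
    exact (mul_left_cancel₀ (wigner_obliquePoint_ne_zero hi')
      (integral_wigner_mul_left (μ := μ) hi' (Nat.zero_le l) hk obliquePoint)).symm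
  have h2 : ∑ i ∈ Finset.range (l + 1), ∫ x, wigner l i k x * conj (wigner l i k x) ∂μ =
      (μ.real Set.univ : ℂ) := by
    rw [← integral_finsetSum _ fun n _ => integrable_mul_conj _ _]
    have : ∀ x, ∑ i ∈ Finset.range (l + 1), wigner l i k x * conj (wigner l i k x) = 1 := by
      intro x
      have h := sum_norm_wigner_sq hk x
      simp_rw [Complex.mul_conj']
      exact_mod_cast h
    simp [this]
  rw [Finset.sum_congr rfl h1, Finset.sum_const, Finset.card_range, nsmul_eq_mul] at h2
  rw [h1 j (Finset.mem_range.mpr (Nat.lt_succ_of_le hj))]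
  push_cast at h2 ⊢
  rw [eq_div_iff (by exact_mod_cast Nat.succ_ne_zero l), mul_comm]
  exact h2

end Orthogonality

/-! ### The Hilbert basis of normalized matrix coefficients -/

section Basis

open ComplexConjugate

/-- Indices of matrix coefficients: the degree, the row and the column. -/
abbrev WaveIndex : Type := Σ l : ℕ, Fin (l + 1) × Fin (l + 1)

/-- The matrix coefficients, normalized in `L²`. -/
noncomputable def waveFun (μ : Measure S3) (i : WaveIndex) : C(S3, ℂ) :=
  (Real.sqrt ((i.1 + 1) / μ.real Set.univ) : ℂ) • wigner i.1 i.2.1 i.2.2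

theorem waveFun_apply (μ : Measure S3) (i : WaveIndex) (x : S3) :
    waveFun μ i x = (Real.sqrt ((i.1 + 1) / μ.real Set.univ) : ℂ) * wigner i.1 i.2.1 i.2.2 x := rfl

/-- The eigenvalue of `-κ Δ` on a matrix coefficient. -/
noncomputable def waveEigenvalue (κ : ℝ) (i : WaveIndex) : ℝ := κ * (i.1 * (i.1 + 2))

theorem WaveIndex.row_le (i : WaveIndex) : (i.2.1 : ℕ) ≤ i.1 := Nat.lt_succ_iff.mp i.2.1.2

theorem WaveIndex.col_le (i : WaveIndex) : (i.2.2 : ℕ) ≤ i.1 := Nat.lt_succ_iff.mp i.2.2.2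

variable (μ : Measure S3) [μ.IsHaarMeasure]

/-- The class in `L^p` of a normalized matrix coefficient. -/
noncomputable def wave (p : ℝ≥0∞) [Fact (1 ≤ p)] (i : WaveIndex) : Lp ℂ p μ :=
  ContinuousMap.toLp p μ ℂ (waveFun μ i)

theorem coeFn_wave (p : ℝ≥0∞) [Fact (1 ≤ p)] (i : WaveIndex) : wave μ p i =ᵐ[μ] waveFun μ i :=
  ContinuousMap.coeFn_toLp μ _

theorem real_univ_pos : 0 < μ.real Set.univ :=
  ENNReal.toReal_pos (NeZero.ne _) (measure_ne_top _ _)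

theorem inner_wave_wave (i i' : WaveIndex) :
    inner ℂ (wave μ 2 i) (wave μ 2 i') = (Real.sqrt ((i'.1 + 1) / μ.real Set.univ) : ℂ) *
      (Real.sqrt ((i.1 + 1) / μ.real Set.univ) : ℂ) *
      ∫ x, wigner i'.1 i'.2.1 i'.2.2 x * conj (wigner i.1 i.2.1 i.2.2 x) ∂μ := by
  rw [wave, wave, ContinuousMap.inner_toLp, ← integral_const_mul]
  congr 1
  funext x
  rw [waveFun_apply, waveFun_apply, map_mul, Complex.conj_ofReal]
  ring

theorem orthonormal_wave : Orthonormal ℂ (wave μ 2) := by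
  classical
  rw [orthonormal_iff_ite]
  intro i i'
  rw [inner_wave_wave]
  split_ifs with h
  · subst h
    rw [integral_wigner_self i.row_le i.col_le, ← Complex.ofReal_mul, ← Complex.ofReal_mul,
      Real.mul_self_sqrt (by positivity)]
    have := real_univ_pos μ
    rw [div_mul_div_cancel₀ (by positivity), div_self (by positivity), Complex.ofReal_one]
  · refine mul_eq_zero_of_right _ ?_
    obtain ⟨l, j, k⟩ := i
    obtain ⟨l', j', k'⟩ := i'
    by_cases hl : l' = l
    · subst hl
      by_cases hk : k' = k
      · subst hk
        have hj : (j' : ℕ) ≠ j := fun hj => h (by rw [Fin.ext hj])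
        exact integral_wigner_of_ne_left (WaveIndex.row_le ⟨l', j', k'⟩)
          (WaveIndex.row_le ⟨l', j, k'⟩) (WaveIndex.col_le ⟨l', j, k'⟩) hj
      · exact integral_wigner_of_ne_right _ _ (WaveIndex.col_le ⟨l', j', k'⟩)
          (WaveIndex.col_le ⟨l', j, k⟩) fun hk' => hk (Fin.ext hk')
    · exact integral_wigner_of_ne_degree _ _ (WaveIndex.col_le ⟨l', j', k'⟩)
          (WaveIndex.col_le ⟨l, j, k⟩) hl

theorem toLp_rawCoeff_mem_span (m k j : ℕ) :
    ContinuousMap.toLp 2 μ ℂ (rawCoeff m k j) ∈ Submodule.span ℂ (Set.range (wave μ 2)) := by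
  by_cases hj : j ≤ m + k
  · have h := Submodule.subset_span (R := ℂ) (Set.mem_range_self (f := wave μ 2)
      (⟨m + k, ⟨j, by omega⟩, ⟨k, by omega⟩⟩ : WaveIndex))
    have hs := real_univ_pos μ
    have h1 := choose_pos_real hj
    have h2 := choose_pos_real (Nat.le_add_left k m)
    set c : ℂ := (Real.sqrt (((m + k : ℕ) + 1) / μ.real Set.univ) : ℂ) *
      (Real.sqrt ((m + k).choose k / (m + k).choose j) : ℂ) with hc
    have hc0 : c ≠ 0 := by
      refine mul_ne_zero ?_ ?_ <;> rw [Complex.ofReal_ne_zero] <;> positivity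
    have h3 : wave μ 2 (⟨m + k, ⟨j, by omega⟩, ⟨k, by omega⟩⟩ : WaveIndex) =
        c • ContinuousMap.toLp 2 μ ℂ (rawCoeff m k j) := by
      rw [wave, ← map_smul, hc, mul_smul]
      simp only [waveFun, wigner, Nat.add_sub_cancel]
    rw [h3] at h
    exact (Submodule.smul_mem_iff _ hc0).mp h
  · have : rawCoeff m k j = 0 := coeff_colPoly_eq_zero _ _ _ _ (not_le.mp hj)
    rw [this, map_zero]
    exact Submodule.zero_mem _

/-- Uniform density of the coefficients passes to `L²` because the map from continuous functions is
continuous with dense range. -/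
theorem span_wave_dense : ⊤ ≤ (Submodule.span ℂ (Set.range (wave μ 2))).topologicalClosure := by
  set K := (Submodule.span ℂ (Set.range (wave μ 2))).topologicalClosure with hK
  have hKc : IsClosed (K : Set (Lp ℂ 2 μ)) := Submodule.isClosed_topologicalClosure _
  let J : C(S3, ℂ) →L[ℂ] Lp ℂ 2 μ := ContinuousMap.toLp 2 μ ℂ
  have h1 : coeffSpan ℂ zFun wFun (-star wFun) (star zFun) ≤ K.comap J.toLinearMap := by
    refine Submodule.span_le.mpr ?_
    rintro f ⟨m, k, j, rfl⟩
    exact Submodule.le_topologicalClosure _ (toLp_rawCoeff_mem_span μ m k j)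
  have h2 : (⊤ : Submodule ℂ C(S3, ℂ)) ≤ K.comap J.toLinearMap := by
    rw [← dense_coeffSpan]
    exact Submodule.topologicalClosure_minimal _ h1 (hKc.preimage J.continuous)
  intro u _
  have h3 : DenseRange J := ContinuousMap.toLp_denseRange ℂ μ ℂ (by simp)
  have h4 : u ∈ closure (Set.range J) := h3 u
  refine closure_minimal ?_ hKc h4
  rintro _ ⟨f, rfl⟩
  exact h2 (Submodule.mem_top (x := f))

/-- The Hilbert basis of `L²(𝕊³)` given by the normalized matrix coefficients. -/
noncomputable def waveBasis : HilbertBasis WaveIndex ℂ (Lp ℂ 2 μ) :=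
  HilbertBasis.mk (orthonormal_wave μ) (span_wave_dense μ)

theorem waveBasis_apply (i : WaveIndex) : waveBasis μ i = wave μ 2 i := by
  rw [waveBasis, HilbertBasis.coe_mk]

theorem wave_mem_laplaceEigenspace (κ : ℝ) (i : WaveIndex) :
    wave μ 2 i ∈ laplaceEigenspace μ κ (waveEigenvalue κ i) := by
  refine Submodule.le_topologicalClosure _ (Submodule.subset_span ⟨waveFun μ i, ?_, fun x => ?_,
    coeFn_wave μ 2 i⟩)
  · exact (Submodule.smul_mem _ _ (wigner_mem_weightSpace i.1 i.2.1 i.2.2)).1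
  · have h := (Submodule.smul_mem _ (Real.sqrt ((i.1 + 1) / μ.real Set.univ) : ℂ)
      (wigner_mem_weightSpace i.1 i.2.1 i.2.2)).2.2 x
    rw [Nat.sub_add_cancel i.col_le] at h
    rw [waveFun, h, waveEigenvalue]
    push_cast
    ring

/-- The eigenspace is defined by arbitrary smooth eigenfunctions, so it must be shown to contain
nothing beyond the expected basis vectors. The orthogonal complement of one vector is closed, which
reduces this to symmetry of the Laplacian. -/
theorem inner_wave_eq_zero {κ lam : ℝ} (hκ : 0 < κ) {i : WaveIndex} (hi : waveEigenvalue κ i ≠ lam)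
    {u : Lp ℂ 2 μ} (hu : u ∈ laplaceEigenspace μ κ lam) : inner ℂ (wave μ 2 i) u = 0 := by
  have h : laplaceEigenspace μ κ lam ≤ (Submodule.span ℂ {wave μ 2 i})ᗮ := by
    refine Submodule.topologicalClosure_minimal _ (Submodule.span_le.mpr ?_)
      (Submodule.isClosed_orthogonal _)
    rintro v ⟨f, hf, hlam, hv⟩
    rw [SetLike.mem_coe, Submodule.mem_orthogonal_singleton_iff_inner_right]
    have hfs := hf.hasSmoothExt
    have hv2 : v = ContinuousMap.toLp 2 μ ℂ ⟨f, hfs.continuous⟩ :=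
      Lp.ext (hv.trans (ContinuousMap.coeFn_toLp (p := 2) (𝕜 := ℂ) μ
        (⟨f, hfs.continuous⟩ : C(S3, ℂ))).symm)
    rw [hv2, wave, ContinuousMap.inner_toLp]
    have h1 : ∀ x, sphereLaplacian f x = -((lam / κ : ℝ) * f x) := by
      intro x
      have hκ' : (κ : ℂ) ≠ 0 := by exact_mod_cast hκ.ne'
      have := hlam x
      push_cast
      field_simp
      linear_combination -this
    have h2 : ∀ x, sphereLaplacian (waveFun μ i) x =
        -((waveEigenvalue κ i / κ : ℝ) * waveFun μ i x) := by
      intro x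
      have h := (Submodule.smul_mem _ (Real.sqrt ((i.1 + 1) / μ.real Set.univ) : ℂ)
        (wigner_mem_weightSpace i.1 i.2.1 i.2.2)).2.2 x
      rw [Nat.sub_add_cancel i.col_le] at h
      rw [waveFun, h, waveEigenvalue, mul_div_cancel_left₀ _ hκ.ne']
    refine integral_mul_conj_eq_zero_of_sphereLaplacian hfs
      (ContMDiff.hasSmoothExt (f := waveFun μ i) (Submodule.smul_mem _ _
        (wigner_mem_weightSpace i.1 i.2.1 i.2.2)).1) (fun hcon => hi ?_) h1 h2
    exact ((div_left_inj' hκ.ne').mp hcon).symm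
  exact Submodule.mem_orthogonal_singleton_iff_inner_right.mp (h hu)

theorem finite_waveEigenvalue {κ : ℝ} (hκ : 0 < κ) (lam : ℝ) :
    Finite {i : WaveIndex // waveEigenvalue κ i = lam} := by
  by_cases h : ∃ i : WaveIndex, waveEigenvalue κ i = lam
  · obtain ⟨⟨l, i⟩, hi⟩ := h
    refine (Set.Finite.subset (Set.finite_range (fun q : Fin (l + 1) × Fin (l + 1) =>
      (⟨l, q⟩ : WaveIndex))) ?_ : Set.Finite {i : WaveIndex | waveEigenvalue κ i = lam}).to_subtype
    rintro ⟨l', q⟩ hq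
    have h1 : waveEigenvalue κ ⟨l', q⟩ = waveEigenvalue κ ⟨l, i⟩ := hq.trans hi.symm
    have h2 := mul_left_cancel₀ hκ.ne' h1
    have h3 : l' * (l' + 2) = l * (l + 2) := by exact_mod_cast h2
    have h4 : l' = l := by nlinarith
    subst h4
    exact ⟨q, rfl⟩
  · push Not at h
    have : IsEmpty {i : WaveIndex // waveEigenvalue κ i = lam} := ⟨fun i => h i.1 i.2⟩
    infer_instance

theorem starProjection_laplaceEigenspace {κ : ℝ} (hκ : 0 < κ) (lam : ℝ)
    [Fintype {i : WaveIndex // waveEigenvalue κ i = lam}] (u : Lp ℂ 2 μ) :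
    (laplaceEigenspace μ κ lam).starProjection u =
      ∑ i : {i : WaveIndex // waveEigenvalue κ i = lam},
        inner ℂ (wave μ 2 i) u • wave μ 2 i := by
  refine Submodule.eq_starProjection_of_mem_of_inner_eq_zero ?_ fun w hw => ?_
  · refine Submodule.sum_mem _ fun i _ => Submodule.smul_mem _ _ ?_
    have := wave_mem_laplaceEigenspace μ κ i
    rwa [i.2] at this
  -- Every Parseval term vanishes: the residual is orthogonal to basis vectors with eigenvalue
  -- `lam`, and `w` to all others.
  · rw [← (waveBasis μ).tsum_inner_mul_inner]
    refine (tsum_congr fun i => ?_).trans tsum_zero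
    rw [waveBasis_apply]
    by_cases hi : waveEigenvalue κ i = lam
    · refine mul_eq_zero_of_left ?_ _
      rw [← inner_conj_symm, inner_sub_right, inner_sum,
        Finset.sum_eq_single (⟨i, hi⟩ : {i : WaveIndex // waveEigenvalue κ i = lam})]
      · rw [inner_smul_right, inner_self_eq_norm_sq_to_K, (orthonormal_wave μ).1]
        simp
      · intro j _ hj
        rw [inner_smul_right, (orthonormal_wave μ).2 (fun h => hj (Subtype.ext h.symm)), mul_zero]
      · exact fun h => absurd (Finset.mem_univ _) h
    · rw [inner_wave_eq_zero μ hκ hi hw, mul_zero]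

/-- Group the basis expansion by eigenvalue: each fibre is finite and sums to the multiple of the
spectral projection. Empty fibres account for real numbers that are not eigenvalues. -/
theorem isBesselPotential_of_hasSum {κ : ℝ} (hκ : 0 < κ) (α : ℝ)
    (A : Lp ℂ 2 μ →L[ℂ] Lp ℂ 2 μ)
    (hA : ∀ u, HasSum (fun i => (((1 + waveEigenvalue κ i) ^ (-α / 2) : ℝ) : ℂ) •
      inner ℂ (wave μ 2 i) u • wave μ 2 i) (A u)) : IsBesselPotential μ κ α A := by
  intro u
  have h := (Equiv.sigmaFiberEquiv (waveEigenvalue κ)).hasSum_iff.mpr (hA u)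
  refine h.sigma fun lam => ?_
  have := finite_waveEigenvalue hκ lam
  have := Fintype.ofFinite {i : WaveIndex // waveEigenvalue κ i = lam}
  rw [starProjection_laplaceEigenspace μ hκ lam u, Finset.smul_sum]
  convert hasSum_fintype _ using 2 with i
  simp [i.2]

end Basis

/-! ### Norm estimates -/

section Norms

open ComplexConjugate

theorem tildeExp_nonneg (p : ℝ≥0∞) : 0 ≤ tildeExp p := by
  unfold tildeExp
  split_ifs with h1 h2
  · exact le_rfl
  · exact zero_le_one
  · have : (2 : ℝ) ≤ p.toReal := by
      rw [← ENNReal.toReal_ofNat]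
      exact ENNReal.toReal_mono h2 (not_le.mp h1).le
    exact div_nonneg (by linarith) (by linarith)

/-- Interpolation between `L²` and the sup norm. -/
theorem eLpNorm_le_of_norm_le {X : Type*} [MeasurableSpace X] {μ : Measure X} {f : X → ℂ} {B : ℝ}
    (hB : 0 ≤ B) (hf : ∀ x, ‖f x‖ ≤ B) (h2 : eLpNorm f 2 μ ≤ 1) {p : ℝ≥0∞} (hp : 2 < p)
    (hp' : p ≠ ⊤) : eLpNorm f p μ ≤ ENNReal.ofReal (B ^ ((p.toReal - 2) / p.toReal)) := by
  have hp2 : (2 : ℝ) < p.toReal := by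
    rw [← ENNReal.toReal_ofNat]
    exact ENNReal.toReal_strict_mono hp' hp
  have h2' : ∫⁻ x, ‖f x‖ₑ ^ (2 : ℝ) ∂μ ≤ 1 := by
    rw [eLpNorm_eq_lintegral_rpow_enorm_toReal (by simp) (by simp), ENNReal.toReal_ofNat,
      ← ENNReal.one_rpow (1 / 2), ENNReal.rpow_le_rpow_iff (by norm_num)] at h2
    exact h2
  have h3 : ∀ x, ‖f x‖ₑ ^ p.toReal ≤ ENNReal.ofReal B ^ (p.toReal - 2) * ‖f x‖ₑ ^ (2 : ℝ) := by
    intro x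
    have h4 : ‖f x‖ₑ ≤ ENNReal.ofReal B := by
      rw [← ofReal_norm]
      exact ENNReal.ofReal_le_ofReal (hf x)
    calc ‖f x‖ₑ ^ p.toReal = ‖f x‖ₑ ^ (p.toReal - 2) * ‖f x‖ₑ ^ (2 : ℝ) := by
          rw [← ENNReal.rpow_add_of_nonneg _ _ (by linarith) (by norm_num), sub_add_cancel]
      _ ≤ _ := by gcongr
  rw [eLpNorm_eq_lintegral_rpow_enorm_toReal (by positivity) hp']
  calc (∫⁻ x, ‖f x‖ₑ ^ p.toReal ∂μ) ^ (1 / p.toReal)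
      ≤ (ENNReal.ofReal B ^ (p.toReal - 2)) ^ (1 / p.toReal) := by
        gcongr
        refine (lintegral_mono h3).trans ?_
        rw [lintegral_const_mul' _ _ (ENNReal.rpow_ne_top_of_nonneg (by linarith)
          ENNReal.ofReal_ne_top)]
        exact mul_le_of_le_one_right' h2'
    _ = ENNReal.ofReal (B ^ ((p.toReal - 2) / p.toReal)) := by
        rw [← ENNReal.rpow_mul, mul_one_div, ENNReal.ofReal_rpow_of_nonneg hB]
        exact div_nonneg (by linarith) (by linarith)

theorem norm_waveFun_le (μ : Measure S3) (i : WaveIndex) (x : S3) :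
    ‖waveFun μ i x‖ ≤ Real.sqrt ((i.1 + 1) / μ.real Set.univ) := by
  rw [waveFun_apply, norm_mul, Complex.norm_real, Real.norm_of_nonneg (Real.sqrt_nonneg _)]
  exact mul_le_of_le_one_right (Real.sqrt_nonneg _) (norm_wigner_le_one i.row_le i.col_le x)

variable (μ : Measure S3) [μ.IsHaarMeasure]

theorem eLpNorm_waveFun_two (i : WaveIndex) : eLpNorm (waveFun μ i) 2 μ = 1 := by
  rw [← eLpNorm_congr_ae (coeFn_wave μ 2 i), ← Lp.enorm_def, ← ofReal_norm,
    (orthonormal_wave μ).1 i, ENNReal.ofReal_one]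

/-- The cases are Hölder on a finite measure space for `p ≤ 2`, the sup bound for `p = ∞`, and
interpolation in between. The half in the exponent comes from the sup bound `√(l+1)`. -/
theorem exists_eLpNorm_waveFun_le (p : ℝ≥0∞) :
    ∃ K : ℝ, 0 ≤ K ∧ ∀ i : WaveIndex, (eLpNorm (waveFun μ i) p μ).toReal ≤
      K * ((i.1 : ℝ) + 1) ^ (tildeExp p / 2) := by
  have hM := real_univ_pos μ
  unfold tildeExp
  split_ifs with h1 h2
  · refine ⟨(μ Set.univ ^ (1 / p.toReal - 1 / (2 : ℝ≥0∞).toReal)).toReal, ENNReal.toReal_nonneg,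
      fun i => ?_⟩
    rw [zero_div, Real.rpow_zero, mul_one]
    refine ENNReal.toReal_mono ?_ ?_
    · exact ENNReal.rpow_ne_top_of_ne_zero (NeZero.ne _) (measure_ne_top _ _)
    · have h := eLpNorm_le_eLpNorm_mul_rpow_measure_univ (μ := μ) h1
        (waveFun μ i).continuous.aestronglyMeasurable
      rwa [eLpNorm_waveFun_two, one_mul] at h
  · subst h2
    refine ⟨Real.sqrt (1 / μ.real Set.univ), Real.sqrt_nonneg _, fun i => ?_⟩
    have h := eLpNorm_le_of_ae_bound (p := ⊤) (μ := μ)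
      (Filter.Eventually.of_forall (norm_waveFun_le μ i))
    rw [ENNReal.toReal_top, inv_zero, ENNReal.rpow_zero, one_mul] at h
    refine (ENNReal.toReal_le_of_le_ofReal (Real.sqrt_nonneg _) h).trans (le_of_eq ?_)
    rw [← Real.sqrt_eq_rpow, ← Real.sqrt_mul (by positivity)]
    congr 1
    ring
  · have hp2 : (2 : ℝ) < p.toReal := by
      rw [← ENNReal.toReal_ofNat]
      exact ENNReal.toReal_strict_mono h2 (not_le.mp h1)
    set s := (p.toReal - 2) / p.toReal with hs
    refine ⟨Real.sqrt (1 / μ.real Set.univ) ^ s, by positivity, fun i => ?_⟩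
    have h := eLpNorm_le_of_norm_le (Real.sqrt_nonneg _) (norm_waveFun_le μ i)
      (eLpNorm_waveFun_two μ i).le (not_le.mp h1) h2
    refine (ENNReal.toReal_le_of_le_ofReal (by positivity) h).trans (le_of_eq ?_)
    rw [show s / 2 = 1 / 2 * s by ring, Real.rpow_mul (by positivity), ← Real.sqrt_eq_rpow,
      ← Real.mul_rpow (Real.sqrt_nonneg _) (Real.sqrt_nonneg _), ← Real.sqrt_mul (by positivity)]
    congr 2
    ring

theorem exists_norm_wave_le (p : ℝ≥0∞) [Fact (1 ≤ p)] :
    ∃ K : ℝ, 0 ≤ K ∧ ∀ i : WaveIndex, ‖wave μ p i‖ ≤ K * ((i.1 : ℝ) + 1) ^ (tildeExp p / 2) := by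
  obtain ⟨K, hK, h⟩ := exists_eLpNorm_waveFun_le μ p
  refine ⟨K, hK, fun i => ?_⟩
  rw [Lp.norm_def, eLpNorm_congr_ae (coeFn_wave μ p i)]
  exact h i

/-- The functional `u ↦ ∫ u ē`, where `e` is a normalized matrix coefficient. -/
noncomputable def waveDual (p q : ℝ≥0∞) [Fact (1 ≤ p)] [Fact (1 ≤ q)] [q.HolderConjugate p]
    (i : WaveIndex) : Lp ℂ p μ →L[ℂ] ℂ :=
  (ContinuousLinearMap.mul ℂ ℂ).lpPairing μ q p (ContinuousMap.toLp q μ ℂ (star (waveFun μ i)))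

theorem waveDual_apply (p q : ℝ≥0∞) [Fact (1 ≤ p)] [Fact (1 ≤ q)] [q.HolderConjugate p]
    (i : WaveIndex) (u : Lp ℂ p μ) :
    waveDual μ p q i u = ∫ x, conj (waveFun μ i x) * u x ∂μ := by
  rw [waveDual, ContinuousLinearMap.lpPairing_eq_integral]
  refine integral_congr_ae ?_
  filter_upwards [ContinuousMap.coeFn_toLp (p := q) (𝕜 := ℂ) μ (star (waveFun μ i))] with x hx
  rw [hx]
  rfl

theorem waveDual_two (i : WaveIndex) (u : Lp ℂ 2 μ) :
    waveDual μ 2 2 i u = inner ℂ (wave μ 2 i) u := by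
  rw [waveDual_apply, L2.inner_def]
  refine integral_congr_ae ?_
  filter_upwards [coeFn_wave μ 2 i] with x hx
  rw [hx, RCLike.inner_apply, mul_comm]

theorem exists_norm_waveDual_le (p q : ℝ≥0∞) [Fact (1 ≤ p)] [Fact (1 ≤ q)]
    [q.HolderConjugate p] : ∃ K : ℝ, 0 ≤ K ∧
      ∀ i : WaveIndex, ‖waveDual μ p q i‖ ≤ K * ((i.1 : ℝ) + 1) ^ (tildeExp q / 2) := by
  obtain ⟨K, hK, h⟩ := exists_eLpNorm_waveFun_le μ q
  set N := ‖(ContinuousLinearMap.mul ℂ ℂ).lpPairing μ q p‖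
  refine ⟨N * K, by positivity, fun i => ?_⟩
  rw [mul_assoc]
  refine (ContinuousLinearMap.le_opNorm _ _).trans (mul_le_mul_of_nonneg_left ?_ (norm_nonneg _))
  rw [Lp.norm_def, eLpNorm_congr_ae (ContinuousMap.coeFn_toLp μ _)]
  have h2 : eLpNorm (⇑(star (waveFun μ i))) q μ = eLpNorm (waveFun μ i) q μ :=
    eLpNorm_congr_norm_ae (Filter.Eventually.of_forall fun x => norm_star (waveFun μ i x))
  rw [h2]
  exact h i

end Norms

/-! ### Summability -/

section Summability

/-- The eigenvalue of `(1 - κ Δ) ^ (-α / 2)` on a matrix coefficient. -/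
noncomputable def waveMultiplier (κ α : ℝ) (i : WaveIndex) : ℝ :=
  (1 + waveEigenvalue κ i) ^ (-α / 2)

theorem waveMultiplier_nonneg {κ : ℝ} (hκ : 0 < κ) (α : ℝ) (i : WaveIndex) :
    0 ≤ waveMultiplier κ α i := by
  unfold waveMultiplier waveEigenvalue
  positivity

theorem waveMultiplier_le {κ α : ℝ} (hκ : 0 < κ) (hα : 0 ≤ α) (i : WaveIndex) :
    waveMultiplier κ α i ≤ min 1 κ ^ (-α / 2) * ((i.1 : ℝ) + 1) ^ (-α) := by
  have hm : 0 < min 1 κ := lt_min one_pos hκ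
  -- Uses `(l+1)² = 1 + l(l+2)`.
  have h1 : min 1 κ * ((i.1 : ℝ) + 1) ^ 2 ≤ 1 + waveEigenvalue κ i := by
    have h2 : min 1 κ * ((i.1 : ℝ) * (i.1 + 2)) ≤ κ * ((i.1 : ℝ) * (i.1 + 2)) :=
      mul_le_mul_of_nonneg_right (min_le_right _ _) (by positivity)
    have h3 := min_le_left 1 κ
    unfold waveEigenvalue
    linarith
  refine (Real.rpow_le_rpow_of_nonpos (by positivity) h1 (by linarith)).trans (le_of_eq ?_)
  rw [Real.mul_rpow hm.le (by positivity), ← Real.rpow_natCast, ← Real.rpow_mul (by positivity)]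
  congr 2
  push_cast
  ring

/-- Degree `l` contributes `(l+1)²` indices, so the condition is `t + 2 < -1`. -/
theorem summable_waveIndex_rpow {t : ℝ} (ht : t < -3) :
    Summable fun i : WaveIndex => ((i.1 : ℝ) + 1) ^ t := by
  rw [summable_sigma_of_nonneg fun i => by positivity]
  refine ⟨fun l => Summable.of_finite, ?_⟩
  have h : Summable fun n : ℕ => ((n + 1 : ℕ) : ℝ) ^ (t + 2) :=
    (summable_nat_add_iff 1).mpr (Real.summable_nat_rpow.mpr (by linarith))
  refine h.congr fun l => ?_
  rw [tsum_fintype]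
  dsimp only
  rw [Finset.sum_const, Finset.card_univ, Fintype.card_prod, Fintype.card_fin,
    nsmul_eq_mul, Nat.cast_succ, Real.rpow_add (by positivity)]
  push_cast
  rw [Real.rpow_ofNat]
  ring

theorem summable_norm_rpow {F₁ F₂ : Type*} [NormedAddCommGroup F₁] [NormedSpace ℂ F₁]
    [NormedAddCommGroup F₂] [NormedSpace ℂ F₂] {x' : WaveIndex → F₁ →L[ℂ] ℂ} {y : WaveIndex → F₂}
    {κ α r s₁ s₂ K₁ K₂ : ℝ} (hκ : 0 < κ) (hr : 0 < r) (hα0 : 0 ≤ α)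
    (hα : 3 / r + (s₂ + s₁) / 2 < α)
    (hx : ∀ i, ‖x' i‖ ≤ K₁ * ((i.1 : ℝ) + 1) ^ (s₁ / 2)) (hK₁ : 0 ≤ K₁)
    (hy : ∀ i, ‖y i‖ ≤ K₂ * ((i.1 : ℝ) + 1) ^ (s₂ / 2)) (hK₂ : 0 ≤ K₂) :
    Summable fun i => ‖(waveMultiplier κ α i : ℂ) • x' i‖ ^ r * ‖y i‖ ^ r := by
  have ht : (-α + s₁ / 2 + s₂ / 2) * r < -3 := by
    have h1 : 3 / r < α - s₁ / 2 - s₂ / 2 := by linarith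
    rw [div_lt_iff₀ hr] at h1
    linarith
  set C := min 1 κ ^ (-α / 2) with hC
  have hm : 0 < min 1 κ := lt_min one_pos hκ
  have hC0 : 0 ≤ C := Real.rpow_nonneg hm.le _
  refine Summable.of_nonneg_of_le (fun i => by positivity) (fun i => ?_)
    ((summable_waveIndex_rpow ht).mul_left ((C * K₁ * K₂) ^ r))
  rw [← Real.mul_rpow (norm_nonneg _) (norm_nonneg _), Real.rpow_mul (by positivity),
    ← Real.mul_rpow (by positivity) (by positivity)]
  refine Real.rpow_le_rpow (by positivity) ?_ hr.le
  rw [norm_smul, Complex.norm_real, Real.norm_of_nonneg (waveMultiplier_nonneg hκ α i),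
    Real.rpow_add (by positivity), Real.rpow_add (by positivity)]
  calc waveMultiplier κ α i * ‖x' i‖ * ‖y i‖
      ≤ (C * ((i.1 : ℝ) + 1) ^ (-α)) * (K₁ * ((i.1 : ℝ) + 1) ^ (s₁ / 2)) *
        (K₂ * ((i.1 : ℝ) + 1) ^ (s₂ / 2)) := by
        gcongr
        · exact waveMultiplier_le hκ hα0 i
        · exact hx i
        · exact hy i
    _ = _ := by ring

/-- The series converges absolutely in operator norm, a rank-one operator having the product of the
two norms as its norm. -/
theorem exists_hasSum_rankOne {ι F₁ F₂ : Type*} [NormedAddCommGroup F₁] [NormedSpace ℂ F₁]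
    [NormedAddCommGroup F₂] [NormedSpace ℂ F₂] [CompleteSpace F₂] {x' : ι → F₁ →L[ℂ] ℂ}
    {y : ι → F₂} (h : Summable fun i => ‖x' i‖ * ‖y i‖) :
    ∃ T : F₁ →L[ℂ] F₂, ∀ u, HasSum (fun i => x' i u • y i) (T u) := by
  have h1 : Summable fun i => (x' i).smulRight (y i) :=
    Summable.of_norm (by simpa only [ContinuousLinearMap.norm_smulRight_apply] using h)
  exact ⟨_, fun u => h1.hasSum.mapL (ContinuousLinearMap.apply ℂ F₂ u)⟩

theorem isRNuclear_of_hasSum {ι F₁ F₂ : Type*} [Countable ι] [Infinite ι] [NormedAddCommGroup F₁]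
    [NormedSpace ℂ F₁] [NormedAddCommGroup F₂] [NormedSpace ℂ F₂] {r : ℝ} {T : F₁ →L[ℂ] F₂}
    {x' : ι → F₁ →L[ℂ] ℂ} {y : ι → F₂} (h : Summable fun i => ‖x' i‖ ^ r * ‖y i‖ ^ r)
    (hT : ∀ u, HasSum (fun i => x' i u • y i) (T u)) : IsRNuclear r T := by
  obtain ⟨d⟩ := nonempty_denumerable ι
  let e : ℕ ≃ ι := (Denumerable.eqv ι).symm
  exact ⟨x' ∘ e, y ∘ e, h.comp_injective e.injective, fun u => e.hasSum_iff.mpr (hT u)⟩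

end Summability

/-! ### Agreement of the operators on different `L^p` spaces -/

section Compatibility

variable {μ : Measure S3} [μ.IsHaarMeasure]

/-- Sums of the same series of multiples of matrix coefficients in two spaces `L^p` agree. -/
theorem ae_eq_of_hasSum {p q : ℝ≥0∞} [Fact (1 ≤ p)] [Fact (1 ≤ q)] {a : WaveIndex → ℂ}
    {u : Lp ℂ p μ} {v : Lp ℂ q μ} (hu : HasSum (fun i => a i • wave μ p i) u)
    (hv : HasSum (fun i => a i • wave μ q i) v) : u =ᵐ[μ] v := by
  have h : ∀ (p : ℝ≥0∞) [Fact (1 ≤ p)] (s : Finset WaveIndex),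
      (∑ i ∈ s, a i • wave μ p i : Lp ℂ p μ) =ᵐ[μ] (∑ i ∈ s, a i • waveFun μ i : C(S3, ℂ)) := by
    intro p _ s
    have : ∑ i ∈ s, a i • wave μ p i =
        ContinuousMap.toLp p μ ℂ (∑ i ∈ s, a i • waveFun μ i) := by
      simp only [map_sum, map_smul, wave]
    rw [this]
    exact ContinuousMap.coeFn_toLp μ _
  -- The partial sums are classes of the same continuous functions, and convergence in either space
  -- implies convergence in measure, whose limit is unique.
  exact tendstoInMeasure_ae_unique
    ((tendstoInMeasure_of_tendsto_Lp hu).congr_left (h p))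
    ((tendstoInMeasure_of_tendsto_Lp hv).congr_left (h q))

end Compatibility

/-! ### The Bessel potential is `r`-nuclear -/

theorem corollary3p8 (μ : Measure S3) [μ.IsHaarMeasure] (κ : ℝ) (hκ : 0 < κ)
    (r α : ℝ) (hr : 0 < r) (hr1 : r ≤ 1)
    (p₁ p₂ q₁ : ℝ≥0∞) [Fact (1 ≤ p₁)] [Fact (1 ≤ p₂)] (hp₁ : p₁ ≠ ⊤) (hp₂ : p₂ ≠ ⊤)
    (hq₁ : p₁.HolderConjugate q₁)
    (hα : 3 / r + (tildeExp p₂ + tildeExp q₁) / 2 < α) :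
    ∃ T : Lp ℂ p₁ μ →L[ℂ] Lp ℂ p₂ μ, IsBesselPotentialLp μ κ α p₁ p₂ T ∧ IsRNuclear r T := by
  have hr3 : 3 ≤ 3 / r := by rw [le_div_iff₀ hr]; linarith
  have ht₂ := tildeExp_nonneg p₂
  have ht₁ := tildeExp_nonneg q₁
  have hα0 : 0 ≤ α := by linarith
  have hq₁' : q₁.HolderConjugate p₁ := hq₁.symm
  have : Fact (1 ≤ q₁) := ⟨ENNReal.HolderConjugate.one_le q₁ p₁⟩
  obtain ⟨K₁, hK₁, hx⟩ := exists_norm_waveDual_le μ p₁ q₁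
  obtain ⟨K₂, hK₂, hy⟩ := exists_norm_wave_le μ p₂
  obtain ⟨L₁, hL₁, hx2⟩ := exists_norm_waveDual_le μ 2 2
  obtain ⟨L₂, hL₂, hy2⟩ := exists_norm_wave_le μ 2
  have ht : tildeExp 2 = 0 := if_pos le_rfl
  have hs := summable_norm_rpow hκ hr hα0 hα hx hK₁ hy hK₂
  -- Since `3 ≤ 3/r`, the same `α` is above the threshold for exponent `1`, which yields absolute
  -- convergence and hence the operators themselves, also on `L²`, where both correction exponents
  -- are zero.
  have hs1 := summable_norm_rpow (r := 1) hκ one_pos hα0 (by linarith) hx hK₁ hy hK₂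
  have hs2 := summable_norm_rpow (r := 1) hκ one_pos hα0 (by rw [ht]; linarith) hx2 hL₁ hy2 hL₂
  simp only [Real.rpow_one] at hs1 hs2
  obtain ⟨T, hT⟩ := exists_hasSum_rankOne hs1
  obtain ⟨A, hA⟩ := exists_hasSum_rankOne hs2
  refine ⟨T, ⟨A, isBesselPotential_of_hasSum μ hκ α A fun u => ?_, fun u w huw => ?_⟩,
    isRNuclear_of_hasSum hs hT⟩
  · convert hA u using 2 with i
    rw [_root_.smul_apply, waveDual_two, smul_assoc]
    rfl
  · refine ae_eq_of_hasSum (hT u) ?_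
    have h : ∀ i, waveDual μ p₁ q₁ i u = waveDual μ 2 2 i w := by
      intro i
      rw [waveDual_apply, waveDual_apply]
      refine integral_congr_ae ?_
      filter_upwards [huw] with x hx
      rw [hx]
    simpa only [_root_.smul_apply, h] using hA w
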